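/- **Theorem (closed-form upper bound on the ergodic capacity of amplify-and-forward MIMO dual-hop systems).** Let $n_s,n_r,n_d\ge 1$ be integers, $\alpha>0$ and $\rho\ge 0$. Let $\mathbf H_1\in\mathbb C^{n_r\times n_s}$ and $\mathbf H_2\in\mathbb C^{n_d\times n_r}$ be random matrices all of whose entries are jointly independent zero-mean circularly symmetric complex Gaussian variables of unit variance. Put $$a=\frac{\alpha}{n_r(1+\rho)},\qquad \mathbf R_s=\frac{\rho a}{n_s}\mathbf H_2\mathbf H_1\mathbf H_1^\dagger\mathbf H_2^\dagger,\qquad \mathbf R_n=\mathbf I_{n_d}+a\,\mathbf H_2\mathbf H_2^\dagger,$$ and let $$C(\rho)=\tfrac12\,E\left\{\log_2\det\left(\mathbf I_{n_d}+\mathbf R_s\mathbf R_n^{-1}\right)\right\}$$ be the ergodic capacity. Let $q=\min(n_d,n_r)$, $p=\max(n_d,n_r)$, $$\mathcal K=\Big(\prod_{i=1}^q\Gamma(q-i+1)\,\Gamma(p-i+1)\Big)^{-1},$$ and let $\bar{\boldsymbol\Xi}$ be the $q\times q$ matrix with entries, for $1\le m,n\le q$ and $\tau=p-q+m+n$, $$\{\bar{\boldsymbol\Xi}\}_{m,n}=\begin{cases}a^{1-\tau}\,\vartheta_{\tau-1}(a),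 & n\le q-n_s,\\[2pt] a^{1-\tau}\left(\vartheta_{\tau-1}(a)+\dfrac{\rho}{n_s}(n_s-q+n)\,\vartheta_\tau(a)\right), & n>q-n_s,\end{cases}$$ where $\vartheta_t(a)=\Gamma(t)\,U(t,p+q,1/a)$ and $$U(c,b,z)=\frac1{\Gamma(c)}\int_0^\infty e^{-zt}t^{c-1}(1+t)^{b-c-1}\,dt\qquad(c,z>0)$$ is the confluent hypergeometric function of the second kind. Then the expectation defining $C(\rho)$ is finite, $\mathcal K\det\bar{\boldsymbol\Xi}>0$, and $$C(\rho)\le\frac12\log_2\left(\mathcal K\det\bar{\boldsymbol\Xi}\right).$$ -/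

import Mathlib

open MeasureTheory ProbabilityTheory Matrix

noncomputable section

/-- The law `CN(0,1)` of a zero-mean circularly symmetric complex Gaussian variable of unit
variance: real and imaginary parts are independent `N(0, 1/2)`. -/
def stdComplexGaussian : Measure ℂ :=
  ((gaussianReal 0 (1 / 2)).prod (gaussianReal 0 (1 / 2))).map
    (fun z : ℝ × ℝ => (⟨z.1, z.2⟩ : ℂ))

/-- The random channel matrices `H₁` (source to relay, `n_r × n_s`) and `H₂` (relay to
destination, `n_d × n_r`): all the entries of the two matrices are jointly independent and
distributed as `CN(0,1)`. -/
structure IsRayleighDualHop {Ω : Type*} [MeasurableSpace Ω] (μ : Measure Ω) {ns nr nd : ℕ}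
    (H₁ : Ω → Matrix (Fin nr) (Fin ns) ℂ) (H₂ : Ω → Matrix (Fin nd) (Fin nr) ℂ) : Prop where
  law_fst : ∀ i j, HasLaw (fun ω => H₁ ω i j) stdComplexGaussian μ
  law_snd : ∀ i j, HasLaw (fun ω => H₂ ω i j) stdComplexGaussian μ
  indep : iIndepFun
    (Sum.elim (fun (e : Fin nr × Fin ns) ω => H₁ ω e.1 e.2)
      (fun (e : Fin nd × Fin nr) ω => H₂ ω e.1 e.2)) μ

/-- The squared amplification factor `a = α / (n_r (1 + ρ))` of the relay. -/
def relayFactor (nr : ℕ) (α ρ : ℝ) : ℝ := α / (nr * (1 + ρ))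

/-- Covariance `R_s = (ρ a / n_s) H₂ H₁ H₁† H₂†` of the signal received at the destination. -/
def signalCov {ns nr nd : ℕ} (α ρ : ℝ) (A : Matrix (Fin nr) (Fin ns) ℂ)
    (B : Matrix (Fin nd) (Fin nr) ℂ) : Matrix (Fin nd) (Fin nd) ℂ :=
  ((ρ * relayFactor nr α ρ / ns : ℝ) : ℂ) • (B * A * Aᴴ * Bᴴ)

/-- Covariance `R_n = I + a H₂ H₂†` of the noise received at the destination. -/
def noiseCov {nr nd : ℕ} (α ρ : ℝ) (B : Matrix (Fin nd) (Fin nr) ℂ) :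
    Matrix (Fin nd) (Fin nd) ℂ :=
  1 + ((relayFactor nr α ρ : ℝ) : ℂ) • (B * Bᴴ)

/-- `log₂ det (I + R_s R_n⁻¹)` for given channel matrices. For `α, ρ ≥ 0` the matrix `R_n` is
positive definite, and the determinant is a real number `≥ 1`, so taking the real part only
changes its type. -/
def logDetRate {ns nr nd : ℕ} (α ρ : ℝ) (A : Matrix (Fin nr) (Fin ns) ℂ)
    (B : Matrix (Fin nd) (Fin nr) ℂ) : ℝ :=
  Real.logb 2 (1 + signalCov α ρ A B * (noiseCov α ρ B)⁻¹).det.re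

/-- The ergodic capacity `C(ρ) = (1/2) E[log₂ det (I + R_s R_n⁻¹)]` (in b/s/Hz) of the
amplify-and-forward dual-hop system. -/
def ergodicCapacity {Ω : Type*} [MeasurableSpace Ω] (μ : Measure Ω) {ns nr nd : ℕ} (α ρ : ℝ)
    (H₁ : Ω → Matrix (Fin nr) (Fin ns) ℂ) (H₂ : Ω → Matrix (Fin nd) (Fin nr) ℂ) : ℝ :=
  (1 / 2) * ∫ ω, logDetRate α ρ (H₁ ω) (H₂ ω) ∂μ

/-- The confluent hypergeometric function of the second kind `U(c, b, z)` through its integral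
representation, for `c > 0` and `z > 0` (the only arguments that are used). -/
def hyperU (c b z : ℝ) : ℝ :=
  (Real.Gamma c)⁻¹ *
    ∫ t in Set.Ioi (0 : ℝ), Real.exp (-(z * t)) * t ^ (c - 1) * (1 + t) ^ (b - c - 1)

/-- `ϑ_τ(a) = Γ(τ) U(τ, p + q, 1/a)`. -/
def vartheta (p q : ℕ) (τ a : ℝ) : ℝ :=
  Real.Gamma τ * hyperU τ (p + q) (1 / a)

/-- `𝒦 = (∏_{i=1}^q Γ(q - i + 1) Γ(p - i + 1))⁻¹`. -/
def normConst (p q : ℕ) : ℝ :=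
  (∏ i ∈ Finset.Icc 1 q,
    Real.Gamma ((q : ℝ) - (i : ℝ) + 1) * Real.Gamma ((p : ℝ) - (i : ℝ) + 1))⁻¹

/-- The entry of `Ξ̄` in row `m` and column `n`, where `1 ≤ m, n ≤ q`, with
`τ = p - q + m + n`. -/
def xiBarEntry (ns p q : ℕ) (a ρ : ℝ) (m n : ℕ) : ℝ :=
  let τ : ℝ := (p : ℝ) - q + m + n
  if n + ns ≤ q then
    a ^ (1 - τ) * vartheta p q (τ - 1) a
  else
    a ^ (1 - τ) *
      (vartheta p q (τ - 1) a + ρ / ns * ((ns : ℝ) - q + n) * vartheta p q τ a)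

/-- The `q × q` matrix `Ξ̄`; `Fin q` counts from `0`, the rows and columns from `1`. -/
def xiBar (ns p q : ℕ) (a ρ : ℝ) : Matrix (Fin q) (Fin q) ℝ :=
  Matrix.of fun i j => xiBarEntry ns p q a ρ ((i : ℕ) + 1) ((j : ℕ) + 1)

/-- `𝒦 det Ξ̄` for the system `(n_s, n_r, n_d)`, with `p = max(n_d, n_r)`, `q = min(n_d, n_r)`. -/
def capacityBoundArg (ns nr nd : ℕ) (α ρ : ℝ) : ℝ :=
  normConst (max nd nr) (min nd nr) *
    (xiBar ns (max nd nr) (min nd nr) (relayFactor nr α ρ) ρ).det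

end

/-!
By concavity of the logarithm, the ergodic capacity is at most `(1/2) log₂ E det (1 + R_s R_n⁻¹)`
(`ergodicCapacity_le_logb_meanRateDet`), so the theorem follows once this mean is computed exactly
and recognised as `𝒦 det Ξ̄` (`meanRateDet_eq_capacityBoundArg`).

**The mean.** Since `det (1 + R_s R_n⁻¹) = det (R_n + R_s) / det R_n`, the first hop only enters a
determinant `det (Y + L (∑ⱼ hⱼ hⱼ†) R)` with independent columns `hⱼ`. Such a determinant is affine
in each `hⱼ hⱼ†`, so averaging one column applies `1 + d/dX` to the pencil `det (Y + X L R)`, and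
`n` columns give the functional `fallingPairing n : Q ↦ ((1 + d/dX)ⁿ Q)(0)`
(`integral_prod_weight_mul_det_add_sum`). What remains is
`g(β) = E det (1 + β W) / det (1 + a W)` for a Wishart matrix `W = ∑ⱼ hⱼ hⱼ†`. Here
`1 / det (1 + a W) = E exp (-a v† W v)` for a Gaussian vector `v` independent of `W`. For fixed `v`
the exponential only changes the covariance of the `hⱼ` into `(1 + a v v†)⁻¹`, and the same column
average applies. The result (`integral_det_div_det`) is that `g` is an explicit polynomial
`wishartRatioPoly` of degree at most `q` whose coefficients involve two negative moments of
`1 + a ‖v‖²`. The mean is then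
`fallingPairing n_s (g (a + c X))` with `c = ρ a / n_s`.

**The determinant.** Write `E_k` for the coefficients of `g (a + X)`, so that `E_0 = g(a) = 1`. The
reversed polynomial `x ^ q g(-1/x)` is a combination of two Laguerre polynomials, and the weights
of the combination are such that it is orthogonal to all polynomials of degree below `q` for the
weight `x ^ (p - q) e ^ (-x) / (1 + a x)` (`integral_eval_mul_wishartRatioPoly_eval`). Expanded
around `a`, this says `∑ₖ (-1)ᵏ E_k G_{q-k} = 0` for the columns `G_0, …, G_q` of moments of that
weight in the basis `xⁿ (1 + a x) ^ (q - n)`. The substitution `t = a x` in the integral defining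
`U` shows that column `j` of `Ξ̄` (counted from `0`) is `G_j + c (n_s - q + 1 + j)₊ G_{j+1}`. Only
`G_q` has to be eliminated, and `det Ξ̄` becomes `det (G_0, …, G_{q-1})` times
`∑ₖ E_k cᵏ n_s (n_s - 1) ⋯ (n_s - k + 1)`, which is the mean (`det_add_mul_succ_of_sum_eq_zero`).
Finally `det (G_0, …, G_{q-1})` reduces to the Hankel determinant of the factorials
`(p - q + i + j)!` and equals `𝒦⁻¹` (`det_homogeneousMoment`, `normConst_eq`).
-/

/-! ### Jacobi's formula and the matrix determinant lemma -/

open Polynomial in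
/-- **Jacobi's formula** for the derivative of the determinant of a polynomial matrix. -/
theorem Polynomial.derivative_det_eq_trace_adjugate {R n : Type*} [CommRing R] [Fintype n]
    [DecidableEq n] (A : Matrix n n R[X]) :
    derivative A.det = (A.adjugate * A.map derivative).trace := by
  have h1 : derivative A.det
      = ∑ i, (A.updateCol i (fun k => derivative (A k i))).det := by
    simp_rw [Matrix.det_apply, derivative_sum]
    rw [Finset.sum_comm]
    refine Finset.sum_congr rfl fun σ _ => ?_
    rw [← Finset.smul_sum, Units.smul_def, Units.smul_def, derivative_smul, derivative_prod_finset]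
    congr 1
    refine Finset.sum_congr rfl fun i _ => ?_
    rw [← Finset.prod_erase_mul _ _ (Finset.mem_univ i)]
    congr 1
    · refine Finset.prod_congr rfl fun j hj => ?_
      rw [Matrix.updateCol_ne (Finset.ne_of_mem_erase hj)]
    · simp
  rw [h1, Matrix.trace]
  refine Finset.sum_congr rfl fun i _ => ?_
  rw [← Matrix.cramer_apply, Matrix.cramer_eq_adjugate_mulVec]
  simp [Matrix.mulVec, Matrix.mul_apply, dotProduct]

/-- The matrix determinant lemma without an invertibility hypothesis. -/
theorem Matrix.det_add_vecMulVec_eq_add_trace {n : Type*} [Fintype n] [DecidableEq n]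
    (A : Matrix n n ℂ) (u v : n → ℂ) :
    (A + vecMulVec u v).det = A.det + (A.adjugate * vecMulVec u v).trace := by
  -- for invertible matrices this is the usual lemma; both sides are continuous, and `A + z • 1` is
  -- invertible for all but finitely many `z`
  have hreg : ∀ B : Matrix n n ℂ, B.det ≠ 0 →
      (B + vecMulVec u v).det = B.det + (B.adjugate * vecMulVec u v).trace := by
    intro B hB
    have h := det_add_replicateCol_mul_replicateRow (ι := Unit) (A := B)
      (isUnit_iff_ne_zero.2 hB) u v
    rw [← vecMulVec_eq] at h
    rw [h, det_unique (n := Unit), Matrix.add_apply, one_apply_eq, mul_add, mul_one, inv_def,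
      Matrix.mul_smul, Matrix.smul_mul, Matrix.smul_apply, smul_eq_mul, ← mul_assoc,
      Ring.mul_inverse_cancel _ (isUnit_iff_ne_zero.2 hB), one_mul, Matrix.trace_mul_comm,
      vecMulVec_eq Unit, Matrix.mul_assoc, Matrix.mul_assoc (replicateCol Unit u),
      Matrix.trace_mul_comm (replicateCol Unit u), Matrix.mul_assoc]
    simp [Matrix.trace]
  have hfin : {z : ℂ | (A + z • (1 : Matrix n n ℂ)).det = 0}.Finite := by
    refine ((-A).charpoly.rootSet_finite ℂ).subset fun z hz => ?_
    have h0 : (-A).charpoly ≠ 0 := (Matrix.charpoly_monic _).ne_zero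
    rw [Polynomial.mem_rootSet_of_ne h0, Polynomial.coe_aeval_eq_eval, Matrix.eval_charpoly]
    rw [Set.mem_ofPred_eq] at hz
    rw [← hz]
    congr 1
    ext i j
    simp [Matrix.smul_one_eq_diagonal, Matrix.scalar_apply, add_comm]
  have hdense : Dense {z : ℂ | (A + z • (1 : Matrix n n ℂ)).det = 0}ᶜ :=
    hfin.countable.dense_compl ℂ
  have hc : Continuous fun z : ℂ => A + z • (1 : Matrix n n ℂ) := by fun_prop
  have hcl : IsClosed {z : ℂ | (A + z • (1 : Matrix n n ℂ) + vecMulVec u v).det =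
      (A + z • (1 : Matrix n n ℂ)).det +
        ((A + z • (1 : Matrix n n ℂ)).adjugate * vecMulVec u v).trace} := by
    refine isClosed_eq ?_ ?_
    · exact (hc.add continuous_const).matrix_det
    · exact hc.matrix_det.add ((hc.matrix_adjugate.matrix_mul continuous_const).matrix_trace)
  have := hcl.closure_subset_iff.2 (fun z hz => hreg _ hz) (hdense 0)
  simpa using this

/-! ### The functional `Q ↦ ((1 + d/dX)ⁿ Q)(0)` -/

/-- The linear functional `Q ↦ ∑ₖ n (n - 1) ⋯ (n - k + 1) Qₖ` on polynomials, that is,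
`Q ↦ ((1 + d/dX)ⁿ Q)(0)`. -/
def fallingPairing (R : Type*) [CommRing R] (n : ℕ) : Polynomial R →ₗ[R] R :=
  Polynomial.lsum fun k => (n.descFactorial k : R) • LinearMap.id

section fallingPairing
open Polynomial
variable {R : Type*} [CommRing R]

theorem fallingPairing_monomial (n k : ℕ) (c : R) :
    fallingPairing R n (monomial k c) = n.descFactorial k * c := by
  simp [fallingPairing]

theorem fallingPairing_C (n : ℕ) (c : R) : fallingPairing R n (C c) = c := by
  rw [← monomial_zero_left, fallingPairing_monomial]; simp

theorem fallingPairing_eq_sum_range (n N : ℕ) (Q : R[X]) (hQ : Q.natDegree < N) :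
    fallingPairing R n Q = ∑ k ∈ Finset.range N, (n.descFactorial k : R) * Q.coeff k := by
  conv_lhs => rw [Q.as_sum_range' N hQ]
  simp [fallingPairing_monomial]

theorem fallingPairing_zero (Q : R[X]) : fallingPairing R 0 Q = Q.eval 0 := by
  induction Q using Polynomial.induction_on' with
  | add p q hp hq => simp [hp, hq]
  | monomial k c => cases k <;> simp [fallingPairing_monomial, fallingPairing_C]

theorem fallingPairing_succ (n : ℕ) (Q : R[X]) :
    fallingPairing R (n + 1) Q = fallingPairing R n (Q + derivative Q) := by
  induction Q using Polynomial.induction_on' with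
  | add p q hp hq => rw [map_add, hp, hq, ← map_add]; congr 1; simp; ring
  | monomial k c =>
    rw [map_add, derivative_monomial]
    simp only [fallingPairing_monomial]
    cases k with
    | zero => simp
    | succ k =>
      rw [Nat.succ_descFactorial_succ, Nat.descFactorial_succ]
      simp only [Nat.add_sub_cancel]
      rcases le_or_gt k n with h | h
      · push_cast [Nat.cast_sub h]; ring
      · rw [Nat.descFactorial_of_lt h]; simp

theorem fallingPairing_succ_X_mul (n : ℕ) (Q : R[X]) :
    fallingPairing R (n + 1) (X * Q) = (n + 1) * fallingPairing R n Q := by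
  induction Q using Polynomial.induction_on' with
  | add p q hp hq => rw [mul_add, map_add, hp, hq, map_add]; ring
  | monomial k c =>
    rw [X_mul_monomial, fallingPairing_monomial, fallingPairing_monomial,
      Nat.succ_descFactorial_succ]
    push_cast; ring

theorem fallingPairing_X_mul (n : ℕ) (Q : R[X]) :
    fallingPairing R n (X * Q)
      = n * fallingPairing R n Q - fallingPairing R n (X * derivative Q) := by
  induction Q using Polynomial.induction_on' with
  | add p q hp hq => simp only [mul_add, map_add, hp, hq]; ring
  | monomial k c =>
    rw [X_mul_monomial, derivative_monomial, X_mul_monomial]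
    cases k with
    | zero => simp [fallingPairing_monomial, fallingPairing_C]
    | succ k =>
      simp only [fallingPairing_monomial, Nat.add_sub_cancel]
      rcases le_or_gt (k + 1) n with h | h
      · rw [Nat.descFactorial_succ n (k + 1)]; push_cast [Nat.cast_sub h]; ring
      · rw [Nat.descFactorial_of_lt h, Nat.descFactorial_of_lt (by omega)]; simp

theorem fallingPairing_map {S : Type*} [CommRing S] (f : R →+* S) (n : ℕ) (Q : R[X]) :
    fallingPairing S n (Q.map f) = f (fallingPairing R n Q) := by
  induction Q using Polynomial.induction_on' with
  | add p q hp hq => simp [hp, hq]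
  | monomial k c => simp [fallingPairing_monomial]

end fallingPairing

open Polynomial in
/-- On polynomials of bounded degree, every linear functional is a combination of evaluations;
this is what allows such a functional to be exchanged with an integral. -/
theorem Polynomial.exists_linearMap_eq_sum_eval {K : Type*} [Field K] [CharZero K]
    (ℓ : K[X] →ₗ[K] K) (N : ℕ) :
    ∃ c : Fin N → K, ∀ Q : K[X], Q.degree < N → ℓ Q = ∑ i, c i * Q.eval ((i : ℕ) : K) := by
  have hinj : Set.InjOn (fun i : Fin N => ((i : ℕ) : K)) (Finset.univ : Finset (Fin N)) := by
    intro i _ j _ h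
    exact Fin.ext (Nat.cast_injective h)
  refine ⟨fun i => ℓ (Lagrange.basis Finset.univ (fun i : Fin N => ((i : ℕ) : K)) i),
    fun Q hQ => ?_⟩
  conv_lhs => rw [Lagrange.eq_interpolate hinj (f := Q) (by simpa using hQ)]
  rw [Lagrange.interpolate_apply, map_sum]
  refine Finset.sum_congr rfl fun i _ => ?_
  rw [← smul_eq_C_mul, map_smul, smul_eq_mul, mul_comm]

/-! ### Random variables and matrices with moments of all orders -/

/-- The complex-valued function `f` has finite moments of all orders under `μ`. Such functions
form an algebra, so they provide the integrability of polynomials in Gaussian variables. -/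
def HasAllMoments {α : Type*} [MeasurableSpace α] (f : α → ℂ) (μ : Measure α) : Prop :=
  ∀ p : ENNReal, p ≠ ⊤ → MemLp f p μ

namespace HasAllMoments

variable {α : Type*} [MeasurableSpace α] {μ : Measure α} {f g : α → ℂ}

theorem integrable (hf : HasAllMoments f μ) : Integrable f μ :=
  memLp_one_iff_integrable.1 (hf 1 (by simp))

theorem const [IsFiniteMeasure μ] (c : ℂ) : HasAllMoments (fun _ => c) μ :=
  fun _ _ => memLp_const c

theorem add (hf : HasAllMoments f μ) (hg : HasAllMoments g μ) :
    HasAllMoments (fun x => f x + g x) μ :=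
  fun p hp => (hf p hp).add (hg p hp)

theorem mul (hf : HasAllMoments f μ) (hg : HasAllMoments g μ) :
    HasAllMoments (fun x => f x * g x) μ := by
  intro p hp
  have h2 : (2 * p : ENNReal) ≠ ⊤ := ENNReal.mul_ne_top (by simp) hp
  have : ENNReal.HolderTriple (2 * p) (2 * p) p := by
    constructor
    rw [ENNReal.mul_inv (by simp) (by simp), ← add_mul, ENNReal.inv_two_add_inv_two, one_mul]
  exact (hg (2 * p) h2).mul (hf (2 * p) h2)

theorem sum [IsFiniteMeasure μ] {ι : Type*} (s : Finset ι) {f : ι → α → ℂ}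
    (hf : ∀ i ∈ s, HasAllMoments (f i) μ) : HasAllMoments (fun x => ∑ i ∈ s, f i x) μ :=
  fun p hp => memLp_finsetSum s fun i hi => hf i hi p hp

theorem prod [IsFiniteMeasure μ] {ι : Type*} (s : Finset ι) {f : ι → α → ℂ}
    (hf : ∀ i ∈ s, HasAllMoments (f i) μ) : HasAllMoments (fun x => ∏ i ∈ s, f i x) μ := by
  classical
  induction s using Finset.induction_on with
  | empty => simpa using const 1
  | insert a s ha ih =>
    simp only [Finset.prod_insert ha]
    exact (hf a (by simp)).mul (ih fun i hi => hf i (by simp [hi]))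

theorem star (hf : HasAllMoments f μ) : HasAllMoments (fun x => star (f x)) μ :=
  fun p hp => (hf p hp).star

theorem comp_measurePreserving {β : Type*} [MeasurableSpace β] {ν : Measure β} {e : β → α}
    (hf : HasAllMoments f μ) (he : MeasurePreserving e ν μ) :
    HasAllMoments (fun x => f (e x)) ν :=
  fun p hp => (hf p hp).comp_measurePreserving he

theorem of_bound [IsFiniteMeasure μ] (hf : AEStronglyMeasurable f μ) (C : ℝ)
    (hC : ∀ x, ‖f x‖ ≤ C) : HasAllMoments f μ :=
  fun _ _ => MemLp.of_bound hf C (Filter.Eventually.of_forall hC)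

end HasAllMoments

/-- All entries of the random matrix `A` have finite moments of all orders. -/
def MatrixHasAllMoments {α m n : Type*} [MeasurableSpace α] (A : α → Matrix m n ℂ)
    (μ : Measure α) : Prop :=
  ∀ i j, HasAllMoments (fun x => A x i j) μ

namespace MatrixHasAllMoments

variable {α l m n : Type*} [MeasurableSpace α] {μ : Measure α}

theorem const [IsFiniteMeasure μ] (A : Matrix m n ℂ) : MatrixHasAllMoments (fun _ => A) μ :=
  fun _ _ => HasAllMoments.const _

theorem add {A B : α → Matrix m n ℂ} (hA : MatrixHasAllMoments A μ)
    (hB : MatrixHasAllMoments B μ) : MatrixHasAllMoments (fun x => A x + B x) μ :=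
  fun i j => (hA i j).add (hB i j)

theorem sum [IsFiniteMeasure μ] {ι : Type*} (s : Finset ι) {A : ι → α → Matrix m n ℂ}
    (hA : ∀ k ∈ s, MatrixHasAllMoments (A k) μ) :
    MatrixHasAllMoments (fun x => ∑ k ∈ s, A k x) μ := by
  intro i j
  simp only [Matrix.sum_apply]
  exact HasAllMoments.sum s fun k hk => hA k hk i j

theorem mul [IsFiniteMeasure μ] [Fintype m] {A : α → Matrix l m ℂ} {B : α → Matrix m n ℂ}
    (hA : MatrixHasAllMoments A μ) (hB : MatrixHasAllMoments B μ) :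
    MatrixHasAllMoments (fun x => A x * B x) μ := by
  intro i j
  simp only [Matrix.mul_apply]
  exact HasAllMoments.sum _ fun k _ => (hA _ _).mul (hB _ _)

theorem smul [IsFiniteMeasure μ] {A : α → Matrix m n ℂ} (hA : MatrixHasAllMoments A μ) (c : ℂ) :
    MatrixHasAllMoments (fun x => c • A x) μ :=
  fun i j => (HasAllMoments.const c).mul (hA i j)

theorem conjTranspose {A : α → Matrix m n ℂ} (hA : MatrixHasAllMoments A μ) :
    MatrixHasAllMoments (fun x => (A x)ᴴ) μ :=
  fun i j => (hA j i).star

theorem vecMulVec_star {h : α → m → ℂ} (hh : ∀ i, HasAllMoments (fun x => h x i) μ) :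
    MatrixHasAllMoments (fun x => vecMulVec (h x) (star (h x))) μ :=
  fun i j => (hh i).mul (hh j).star

theorem det [IsFiniteMeasure μ] [Fintype m] [DecidableEq m] {A : α → Matrix m m ℂ}
    (hA : MatrixHasAllMoments A μ) :
    HasAllMoments (fun x => (A x).det) μ := by
  simp only [Matrix.det_apply']
  exact HasAllMoments.sum _ fun σ _ => (HasAllMoments.const _).mul
    (HasAllMoments.prod _ fun i _ => hA _ _)

end MatrixHasAllMoments

/-! ### Mean determinants of sums of independent rank-one matrices -/

section detPencil
open Polynomial
variable {m : Type*} [Fintype m] [DecidableEq m] {R : Type*} [CommRing R]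

/-- The polynomial `t ↦ det (t A + B)`. -/
noncomputable def detPencil (A B : Matrix m m R) : R[X] :=
  ((X : R[X]) • A.map C + B.map C).det

theorem detPencil_natDegree_le (A B : Matrix m m R) :
    (detPencil A B).natDegree ≤ Fintype.card m :=
  natDegree_det_X_add_C_le A B

theorem detPencil_eval (A B : Matrix m m R) (t : R) :
    (detPencil A B).eval t = (t • A + B).det := by
  rw [detPencil, ← coe_evalRingHom, RingHom.map_det]
  congr 1
  ext i j
  simp [mul_comm (A i j) t]

theorem detPencil_derivative_eval (A B : Matrix m m R) (t : R) :
    (derivative (detPencil A B)).eval t = ((t • A + B).adjugate * A).trace := by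
  rw [detPencil, derivative_det_eq_trace_adjugate, ← coe_evalRingHom,
    AddMonoidHom.map_trace, Matrix.map_mul]
  rw [← RingHom.mapMatrix_apply, RingHom.map_adjugate]
  congr 3
  · ext i j; simp [mul_comm (A i j) t]
  · ext i j; simp

theorem detPencil_degree_lt (A B : Matrix m m R) :
    (detPencil A B).degree < (Fintype.card m + 1 : ℕ) :=
  lt_of_le_of_lt degree_le_natDegree
    (by exact_mod_cast Nat.lt_succ_of_le (detPencil_natDegree_le A B))

end detPencil

/-- One random column: the average of `det (Y + L h h† R)` against a normalised weight depends
only on the weighted covariance `M` of `h`. -/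
theorem integral_weight_mul_det_add {r m : Type*} [Fintype r] [Fintype m]
    [DecidableEq m] (ν : Measure (r → ℂ)) [IsProbabilityMeasure ν] {w : (r → ℂ) → ℂ}
    (hw : HasAllMoments w ν) (hent : ∀ i, HasAllMoments (fun h => h i) ν) {M : Matrix r r ℂ}
    (h1 : ∫ h, w h ∂ν = 1) (hM : ∀ i j, ∫ h, w h * (h i * star (h j)) ∂ν = M i j)
    (Y : Matrix m m ℂ) (L : Matrix m r ℂ) (R : Matrix r m ℂ) :
    ∫ h, w h * (Y + L * vecMulVec h (star h) * R).det ∂ν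
      = Y.det + (Y.adjugate * (L * M * R)).trace := by
  have hdet : ∀ h : r → ℂ, w h * (Y + L * vecMulVec h (star h) * R).det
      = w h * Y.det + ∑ i, ∑ j, (R * Y.adjugate * L) i j * (w h * (h j * star (h i))) := by
    intro h
    have e : L * vecMulVec h (star h) * R = vecMulVec (L *ᵥ h) (star h ᵥ* R) := by
      rw [Matrix.mul_vecMulVec, Matrix.vecMulVec_mul]
    have e2 : (Y.adjugate * (L * vecMulVec h (star h) * R)).trace
        = ((R * Y.adjugate * L) * vecMulVec h (star h)).trace := by
      rw [← Matrix.mul_assoc, Matrix.trace_mul_comm, Matrix.mul_assoc, Matrix.mul_assoc]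
    rw [e, det_add_vecMulVec_eq_add_trace, ← e, e2, mul_add, Matrix.trace, Finset.mul_sum]
    congr 1
    refine Finset.sum_congr rfl fun i _ => ?_
    rw [Matrix.diag_apply, Matrix.mul_apply, Finset.mul_sum]
    refine Finset.sum_congr rfl fun j _ => ?_
    rw [vecMulVec_apply, Pi.star_apply]
    ring
  simp_rw [hdet]
  have hi : ∀ i j, HasAllMoments (fun h => w h * (h j * star (h i))) ν :=
    fun i j => hw.mul ((hent j).mul (hent i).star)
  generalize hK : R * Y.adjugate * L = K
  have hrow : ∀ i, Integrable (fun h => ∑ j, K i j * (w h * (h j * star (h i)))) ν :=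
    fun i => integrable_finsetSum _ fun j _ => (hi i j).integrable.const_mul _
  rw [integral_add (hw.integrable.mul_const _) (integrable_finsetSum _ fun i _ => hrow i),
    integral_mul_const, h1, one_mul, integral_finsetSum _ fun i _ => hrow i]
  congr 1
  have e3 : (Y.adjugate * (L * M * R)).trace = (K * M).trace := by
    rw [← hK, ← Matrix.mul_assoc, Matrix.trace_mul_comm, Matrix.mul_assoc, Matrix.mul_assoc]
  rw [e3, Matrix.trace]
  refine Finset.sum_congr rfl fun i _ => ?_
  rw [integral_finsetSum _ fun j _ => (hi i j).integrable.const_mul _, Matrix.diag_apply,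
    Matrix.mul_apply]
  refine Finset.sum_congr rfl fun j _ => ?_
  rw [integral_const_mul, hM]

theorem hasAllMoments_prod_mul_det_sum {r m : Type*} [Fintype r] [Fintype m]
    [DecidableEq m] (ν : Measure (r → ℂ)) [IsProbabilityMeasure ν] {w : (r → ℂ) → ℂ}
    (hw : HasAllMoments w ν) (hent : ∀ i, HasAllMoments (fun h => h i) ν) (n : ℕ)
    (Y : Matrix m m ℂ) (L : Matrix m r ℂ) (R : Matrix r m ℂ) :
    HasAllMoments (fun h : Fin n → r → ℂ =>
      (∏ j, w (h j)) * (Y + L * (∑ j, vecMulVec (h j) (star (h j))) * R).det)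
      (Measure.pi fun _ => ν) := by
  have hev : ∀ j, MeasurePreserving (Function.eval j) (Measure.pi fun _ : Fin n => ν) ν :=
    fun j => measurePreserving_eval _ j
  refine HasAllMoments.mul (HasAllMoments.prod _ fun j _ => hw.comp_measurePreserving (hev j)) ?_
  exact MatrixHasAllMoments.det ((MatrixHasAllMoments.const _).add
    (((MatrixHasAllMoments.const _).mul (MatrixHasAllMoments.sum _ fun j _ =>
      MatrixHasAllMoments.vecMulVec_star fun i => (hent i).comp_measurePreserving (hev j))).mul
        (MatrixHasAllMoments.const _)))

/-- The average of `det (Y + L (∑ⱼ hⱼ hⱼ†) R)` over independent columns `h₁, …, hₙ` with a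
normalised product weight: only the weighted covariance `M` of one column matters. -/
theorem integral_prod_weight_mul_det_add_sum {r m : Type*} [Fintype r] [Fintype m]
    [DecidableEq m] (ν : Measure (r → ℂ)) [IsProbabilityMeasure ν] {w : (r → ℂ) → ℂ}
    (hw : HasAllMoments w ν) (hent : ∀ i, HasAllMoments (fun h => h i) ν) {M : Matrix r r ℂ}
    (h1 : ∫ h, w h ∂ν = 1) (hM : ∀ i j, ∫ h, w h * (h i * star (h j)) ∂ν = M i j) (n : ℕ)
    (Y : Matrix m m ℂ) (L : Matrix m r ℂ) (R : Matrix r m ℂ) :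
    ∫ h : Fin n → r → ℂ, (∏ j, w (h j)) *
        (Y + L * (∑ j, vecMulVec (h j) (star (h j))) * R).det ∂(Measure.pi fun _ => ν)
      = fallingPairing ℂ n (detPencil (L * M * R) Y) := by
  induction n generalizing Y with
  | zero =>
    simp [fallingPairing_zero, detPencil_eval]
  | succ n ih =>
    have hmp := (measurePreserving_piFinSuccAbove (fun _ : Fin (n + 1) => ν) 0).symm
    have hint := (hasAllMoments_prod_mul_det_sum ν hw hent (n + 1) Y L R).integrable
    rw [← hmp.integrable_comp_emb (MeasurableEquiv.measurableEmbedding _)] at hint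
    rw [← hmp.integral_comp']
    simp only [Function.comp_def, MeasurableEquiv.piFinSuccAbove_symm_apply,
      Fin.insertNthEquiv, Fin.prod_univ_succ, Fin.sum_univ_succ, Fin.insertNth_zero,
      Equiv.coe_fn_mk, Fin.cons_succ, Fin.cons_zero] at hint ⊢
    rw [integral_prod _ hint]
    -- the tail is averaged first, by the induction hypothesis
    have inner : ∀ x : r → ℂ, ∫ y : Fin n → r → ℂ, (w x * ∏ j, w (y j)) *
        (Y + L * (vecMulVec x (star x) + ∑ j, vecMulVec (y j) (star (y j))) * R).det
          ∂(Measure.pi fun _ => ν)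
        = w x * fallingPairing ℂ n
            (detPencil (L * M * R) (Y + L * vecMulVec x (star x) * R)) := by
      intro x
      rw [← ih, ← integral_const_mul]
      refine integral_congr_ae (Filter.Eventually.of_forall fun y => ?_)
      simp only [Matrix.mul_add, Matrix.add_mul]
      rw [mul_assoc, ← add_assoc]
    refine (integral_congr_ae (Filter.Eventually.of_forall inner)).trans ?_
    obtain ⟨c, hc⟩ := Polynomial.exists_linearMap_eq_sum_eval (fallingPairing ℂ n)
      (Fintype.card m + 1)
    -- written as a combination of evaluations, the functional commutes with the integral
    rw [fallingPairing_succ, hc _ ?_]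
    · simp_rw [hc _ (detPencil_degree_lt _ _), detPencil_eval, Polynomial.eval_add,
        detPencil_eval, detPencil_derivative_eval, Finset.mul_sum]
      rw [integral_finsetSum]
      · refine Finset.sum_congr rfl fun i _ => ?_
        rw [← integral_weight_mul_det_add ν hw hent h1 hM, ← integral_const_mul]
        refine integral_congr_ae (Filter.Eventually.of_forall fun y => ?_)
        simp only [← add_assoc]
        ring
      · intro i _
        have hm : MatrixHasAllMoments (fun x : r → ℂ => ((i : ℕ) : ℂ) • (L * M * R) +
            (Y + L * vecMulVec x (star x) * R)) ν :=
          (MatrixHasAllMoments.const _).add ((MatrixHasAllMoments.const _).add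
            (((MatrixHasAllMoments.const _).mul
              (MatrixHasAllMoments.vecMulVec_star hent)).mul (MatrixHasAllMoments.const _)))
        exact (hw.mul ((HasAllMoments.const _).mul hm.det)).integrable
    · refine lt_of_le_of_lt (Polynomial.degree_add_le _ _) (max_lt (detPencil_degree_lt _ _) ?_)
      exact lt_of_le_of_lt (Polynomial.degree_derivative_le) (detPencil_degree_lt _ _)

/-! ### The circularly symmetric Gaussian law on `ℂ` -/

section oneDim

theorem measurable_complex_mk : Measurable (fun z : ℝ × ℝ => (⟨z.1, z.2⟩ : ℂ)) :=
  Complex.measurableEquivRealProd.symm.measurable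

instance : IsProbabilityMeasure stdComplexGaussian :=
  Measure.isProbabilityMeasure_map measurable_complex_mk.aemeasurable

theorem integral_stdComplexGaussian {E : Type*} [NormedAddCommGroup E] [NormedSpace ℝ E]
    (f : ℂ → E) :
    ∫ z, f z ∂stdComplexGaussian
      = ∫ x : ℝ × ℝ, f ⟨x.1, x.2⟩ ∂((gaussianReal 0 (1 / 2)).prod (gaussianReal 0 (1 / 2))) :=
  integral_map_equiv Complex.measurableEquivRealProd.symm f

theorem hasAllMoments_id_stdComplexGaussian :
    HasAllMoments (fun z : ℂ => z) stdComplexGaussian := by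
  intro p hp
  have h1 : MemLp (fun x : ℝ × ℝ => x.1)
      p ((gaussianReal 0 (1 / 2)).prod (gaussianReal 0 (1 / 2))) :=
    (memLp_id_gaussianReal' p hp).comp_measurePreserving measurePreserving_fst
  have h2 : MemLp (fun x : ℝ × ℝ => x.2)
      p ((gaussianReal 0 (1 / 2)).prod (gaussianReal 0 (1 / 2))) :=
    (memLp_id_gaussianReal' p hp).comp_measurePreserving measurePreserving_snd
  refine (memLp_map_measure_iff (by fun_prop) measurable_complex_mk.aemeasurable).2 ?_
  have h3 := h1.ofReal (K := ℂ) |>.add ((h2.ofReal (K := ℂ)).const_mul Complex.I)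
  refine h3.congr_norm measurable_complex_mk.aestronglyMeasurable
    (Filter.Eventually.of_forall fun x => ?_)
  have : ((⟨x.1, x.2⟩ : ℂ)) = (x.1 : ℂ) + Complex.I * x.2 := by
    apply Complex.ext <;> simp
  simp [this]

/-- A Gaussian factor `exp (-s x²)` turns `N(0, 1/2)` into a multiple of `N(0, 1/(2(1+s)))`. -/
theorem integral_exp_neg_mul_sq_gaussianReal {s : ℝ} (hs : 0 ≤ s) (f : ℝ → ℝ) :
    ∫ x, Real.exp (-(s * x ^ 2)) * f x ∂(gaussianReal 0 (1 / 2))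
      = (√(1 + s))⁻¹ * ∫ x, f x ∂(gaussianReal 0 (Real.toNNReal (1 / (2 * (1 + s))))) := by
  have hs1 : 0 < 1 + s := by positivity
  have hv : Real.toNNReal (1 / (2 * (1 + s))) ≠ 0 := by
    rw [Ne, Real.toNNReal_eq_zero, not_le]; positivity
  rw [integral_gaussianReal_eq_integral_smul (by norm_num), integral_gaussianReal_eq_integral_smul
    hv, ← integral_const_mul]
  refine integral_congr_ae (Filter.Eventually.of_forall fun x => ?_)
  simp only [gaussianPDFReal, smul_eq_mul, sub_zero]
  rw [Real.coe_toNNReal _ (by positivity)]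
  have e1 : √(2 * Real.pi * (1 / (2 * (1 + s)))) = √Real.pi / √(1 + s) := by
    rw [← Real.sqrt_div Real.pi_pos.le]; congr 1; field_simp
  have e2 : √(2 * Real.pi * ((1 / 2 : NNReal) : ℝ)) = √Real.pi := by
    congr 1; push_cast; ring
  have e3 : Real.exp (-x ^ 2 / (2 * ((1 / 2 : NNReal) : ℝ))) * Real.exp (-(s * x ^ 2))
      = Real.exp (-x ^ 2 / (2 * (1 / (2 * (1 + s))))) := by
    rw [← Real.exp_add]; congr 1; push_cast; field_simp; ring
  rw [e1, e2, ← e3]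
  have h0 : √(1 + s) ≠ 0 := (Real.sqrt_pos.2 hs1).ne'
  field_simp

theorem integral_exp_neg_mul_sq_mul_sq_gaussianReal {s : ℝ} (hs : 0 ≤ s) :
    ∫ x, Real.exp (-(s * x ^ 2)) * x ^ 2 ∂(gaussianReal 0 (1 / 2))
      = (√(1 + s))⁻¹ * (1 / (2 * (1 + s))) := by
  rw [integral_exp_neg_mul_sq_gaussianReal hs]
  congr 1
  have := variance_of_integral_eq_zero (μ := gaussianReal 0 (Real.toNNReal (1 / (2 * (1 + s)))))
    (X := fun x => x) aemeasurable_id' (by simp)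
  rw [variance_fun_id_gaussianReal, Real.coe_toNNReal _ (by positivity)] at this
  exact this.symm

theorem integral_exp_neg_mul_normSq_stdComplexGaussian {s : ℝ} (hs : 0 ≤ s) :
    ∫ z, Real.exp (-(s * ‖z‖ ^ 2)) ∂stdComplexGaussian = (1 + s)⁻¹ := by
  rw [integral_stdComplexGaussian]
  have h1 := integral_exp_neg_mul_sq_gaussianReal hs (fun _ => 1)
  simp only [mul_one, integral_const, probReal_univ, smul_eq_mul] at h1
  calc _ = ∫ x : ℝ × ℝ, Real.exp (-(s * x.1 ^ 2)) * Real.exp (-(s * x.2 ^ 2))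
        ∂((gaussianReal 0 (1 / 2)).prod (gaussianReal 0 (1 / 2))) := by
        refine integral_congr_ae (Filter.Eventually.of_forall fun x => ?_)
        simp only [Complex.sq_norm, Complex.normSq_mk, ← Real.exp_add]
        congr 1; ring
    _ = _ := by
        rw [integral_prod_mul (fun x => Real.exp (-(s * x ^ 2))) fun x => Real.exp (-(s * x ^ 2)),
          h1, ← mul_inv, Real.mul_self_sqrt (by positivity)]

theorem integral_exp_neg_mul_normSq_mul_normSq_stdComplexGaussian {s : ℝ} (hs : 0 ≤ s) :
    ∫ z, Real.exp (-(s * ‖z‖ ^ 2)) * ‖z‖ ^ 2 ∂stdComplexGaussian = (1 + s)⁻¹ * (1 + s)⁻¹ := by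
  rw [integral_stdComplexGaussian]
  have h1 := integral_exp_neg_mul_sq_gaussianReal hs (fun _ => 1)
  simp only [mul_one, integral_const, probReal_univ, smul_eq_mul] at h1
  have h2 := integral_exp_neg_mul_sq_mul_sq_gaussianReal hs
  have hsq : MemLp (fun x : ℝ => x) 2 (gaussianReal 0 (1 / 2)) :=
    memLp_id_gaussianReal' 2 (by simp)
  have hi1 : Integrable (fun x : ℝ => Real.exp (-(s * x ^ 2))) (gaussianReal 0 (1 / 2)) := by
    refine Integrable.of_bound (by fun_prop) 1 (Filter.Eventually.of_forall fun x => ?_)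
    rw [Real.norm_eq_abs, Real.abs_exp]
    exact Real.exp_le_one_iff.2 (by have := mul_nonneg hs (sq_nonneg x); linarith)
  have hi2 : Integrable (fun x : ℝ => Real.exp (-(s * x ^ 2)) * x ^ 2)
      (gaussianReal 0 (1 / 2)) := by
    refine hsq.integrable_sq.bdd_mul (c := 1) (by fun_prop)
      (Filter.Eventually.of_forall fun x => ?_)
    rw [Real.norm_eq_abs, Real.abs_exp]
    exact Real.exp_le_one_iff.2 (by have := mul_nonneg hs (sq_nonneg x); linarith)
  calc _ = ∫ x : ℝ × ℝ, (Real.exp (-(s * x.1 ^ 2)) * x.1 ^ 2) * Real.exp (-(s * x.2 ^ 2))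
          + Real.exp (-(s * x.1 ^ 2)) * (Real.exp (-(s * x.2 ^ 2)) * x.2 ^ 2)
        ∂((gaussianReal 0 (1 / 2)).prod (gaussianReal 0 (1 / 2))) := by
        refine integral_congr_ae (Filter.Eventually.of_forall fun x => ?_)
        simp only [Complex.sq_norm, Complex.normSq_mk]
        have : Real.exp (-(s * (x.1 * x.1 + x.2 * x.2)))
            = Real.exp (-(s * x.1 ^ 2)) * Real.exp (-(s * x.2 ^ 2)) := by
          rw [← Real.exp_add]; congr 1; ring
        rw [this]; ring
    _ = _ := by
        rw [integral_add (hi2.mul_prod hi1) (hi1.mul_prod hi2),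
          integral_prod_mul (fun x => Real.exp (-(s * x ^ 2)) * x ^ 2)
            fun x => Real.exp (-(s * x ^ 2)),
          integral_prod_mul (fun x => Real.exp (-(s * x ^ 2)))
            fun x => Real.exp (-(s * x ^ 2)) * x ^ 2, h1, h2]
        have h0 : √(1 + s) ≠ 0 := (Real.sqrt_pos.2 (by positivity)).ne'
        have h3 : √(1 + s) ^ 2 = 1 + s := Real.sq_sqrt (by positivity)
        have h4 : 1 + s ≠ 0 := by positivity
        field_simp
        rw [h3]; ring

theorem charFunDual_stdComplexGaussian (L : StrongDual ℝ ℂ) :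
    charFunDual stdComplexGaussian L
      = Complex.exp (-((L 1 ^ 2 + L Complex.I ^ 2 : ℝ) : ℂ) / 4) := by
  rw [charFunDual_apply, integral_stdComplexGaussian]
  have hL : ∀ x : ℝ × ℝ, L ⟨x.1, x.2⟩ = L 1 * x.1 + L Complex.I * x.2 := by
    intro x
    have : (⟨x.1, x.2⟩ : ℂ) = x.1 • (1 : ℂ) + x.2 • Complex.I := by
      apply Complex.ext <;> simp
    rw [this, map_add, map_smul, map_smul, smul_eq_mul, smul_eq_mul]; ring
  have hG := fun t => charFun_gaussianReal (μ := 0) (v := 1 / 2) t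
  simp only [charFun_apply_real] at hG
  calc _ = ∫ x : ℝ × ℝ, Complex.exp (((L 1 : ℝ) : ℂ) * x.1 * Complex.I)
          * Complex.exp (((L Complex.I : ℝ) : ℂ) * x.2 * Complex.I)
        ∂((gaussianReal 0 (1 / 2)).prod (gaussianReal 0 (1 / 2))) := by
        refine integral_congr_ae (Filter.Eventually.of_forall fun x => ?_)
        simp only [hL, ← Complex.exp_add]
        congr 1; push_cast; ring
    _ = _ := by
        rw [integral_prod_mul (fun x : ℝ => Complex.exp (((L 1 : ℝ) : ℂ) * x * Complex.I))
          (fun x : ℝ => Complex.exp (((L Complex.I : ℝ) : ℂ) * x * Complex.I)), hG, hG,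
          ← Complex.exp_add]
        congr 1; push_cast; ring

end oneDim

/-! ### Unitary invariance of Gaussian vectors -/

section unitary

variable {ι : Type*} [Fintype ι] [DecidableEq ι]

/-- The sum of squares of a real-linear functional on `ℂⁿ` over the real basis `eᵢ, i eᵢ` does
not change when the functional is composed with a unitary matrix. -/
theorem sum_sq_comp_unitary (L : (ι → ℂ) →ₗ[ℝ] ℝ) {U : Matrix ι ι ℂ} (hU : U * star U = 1) :
    ∑ i, (L (U *ᵥ Pi.single i 1) ^ 2 + L (U *ᵥ Pi.single i Complex.I) ^ 2)
      = ∑ i, (L (Pi.single i 1) ^ 2 + L (Pi.single i Complex.I) ^ 2) := by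
  -- `L z = Re (∑ₖ wₖ zₖ)`
  let w : ι → ℂ := fun k => (L (Pi.single k 1) : ℂ) - L (Pi.single k Complex.I) * Complex.I
  have hL : ∀ z : ι → ℂ, L z = (w ⬝ᵥ z).re := by
    intro z
    have hz : z = ∑ k, ((z k).re • (Pi.single k 1 : ι → ℂ)
        + (z k).im • (Pi.single k Complex.I : ι → ℂ)) := by
      ext j
      rw [Finset.sum_apply, Finset.sum_eq_single j]
      · simp [Complex.re_add_im]
      · intro k _ hk; simp [hk.symm]
      · simp
    conv_lhs => rw [hz]
    simp only [map_sum, map_add, map_smul, smul_eq_mul, dotProduct, Complex.re_sum]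
    refine Finset.sum_congr rfl fun k _ => ?_
    simp [w]; ring
  have key : ∀ V : Matrix ι ι ℂ, V * star V = 1 →
      ∑ i, (L (V *ᵥ Pi.single i 1) ^ 2 + L (V *ᵥ Pi.single i Complex.I) ^ 2)
        = (w ⬝ᵥ star w).re := by
    intro V hV
    have h1 : ∀ i, L (V *ᵥ Pi.single i 1) ^ 2 + L (V *ᵥ Pi.single i Complex.I) ^ 2
        = (((w ᵥ* V) i) * star ((w ᵥ* V) i)).re := by
      intro i
      rw [hL, hL, dotProduct_mulVec, dotProduct_mulVec]
      simp only [dotProduct_single]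
      simp; ring
    simp_rw [h1]
    rw [← Complex.re_sum]
    congr 1
    change (w ᵥ* V) ⬝ᵥ star (w ᵥ* V) = _
    rw [star_vecMul, ← dotProduct_mulVec, mulVec_mulVec, ← star_eq_conjTranspose, hV, one_mulVec]
  rw [key U hU]
  have := key 1 (by simp)
  simp only [one_mulVec] at this
  exact this.symm

/-- The law of a vector of independent `CN(0,1)` variables is invariant under unitary matrices,
because its characteristic function only depends on a sum of squares of the functional. -/
theorem measurePreserving_mulVec_unitary {U : Matrix ι ι ℂ} (hU : U * star U = 1) :
    MeasurePreserving (fun h : ι → ℂ => U *ᵥ h)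
      (Measure.pi fun _ => stdComplexGaussian) (Measure.pi fun _ => stdComplexGaussian) := by
  let T : (ι → ℂ) →L[ℝ] (ι → ℂ) :=
    LinearMap.toContinuousLinearMap ((Matrix.mulVecLin U).restrictScalars ℝ)
  have hT : ∀ h, T h = U *ᵥ h := fun h => rfl
  refine ⟨T.continuous.measurable, ?_⟩
  refine Measure.ext_of_charFunDual (funext fun L => ?_)
  have := charFunDual_map (μ := Measure.pi fun _ : ι => stdComplexGaussian) T L
  refine this.trans ?_
  rw [charFunDual_pi, charFunDual_pi]
  simp_rw [charFunDual_stdComplexGaussian]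
  rw [← Complex.exp_sum, ← Complex.exp_sum]
  congr 1
  simp_rw [neg_div, Finset.sum_neg_distrib, ← Finset.sum_div, ← Complex.ofReal_sum]
  congr 3
  exact sum_sq_comp_unitary L.toLinearMap hU

end unitary

/-! ### Gaussian averages with the weight `exp (-h† W h)` -/

section gaussVec

variable (ι : Type*) [Fintype ι]

/-- The law of a vector of independent `CN(0,1)` variables. -/
noncomputable def gaussVec : Measure (ι → ℂ) := Measure.pi fun _ => stdComplexGaussian

instance : IsProbabilityMeasure (gaussVec ι) := by unfold gaussVec; infer_instance

variable {ι}

theorem hasAllMoments_gaussVec (i : ι) : HasAllMoments (fun h : ι → ℂ => h i) (gaussVec ι) :=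
  hasAllMoments_id_stdComplexGaussian.comp_measurePreserving (measurePreserving_eval _ i)

variable [DecidableEq ι]

theorem integral_gaussVec_unitary {U : Matrix ι ι ℂ} (hU : U * star U = 1) (f : (ι → ℂ) → ℂ) :
    ∫ h, f h ∂(gaussVec ι) = ∫ g, f (U *ᵥ g) ∂(gaussVec ι) := by
  refine ((measurePreserving_mulVec_unitary hU).integral_comp ?_ f).symm
  refine Continuous.measurableEmbedding (f := fun h : ι → ℂ => U *ᵥ h) (by fun_prop) ?_
  refine Function.LeftInverse.injective (g := fun h => star U *ᵥ h) fun h => ?_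
  change star U *ᵥ (U *ᵥ h) = h
  rw [mulVec_mulVec, mul_eq_one_comm.1 hU, one_mulVec]

theorem exp_neg_quadForm_diagonal (d : ι → ℝ) (g : ι → ℂ) :
    Complex.exp (-(star g ⬝ᵥ diagonal (fun i => (d i : ℂ)) *ᵥ g))
      = ∏ k, ((Real.exp (-(d k * ‖g k‖ ^ 2)) : ℝ) : ℂ) := by
  simp_rw [Complex.ofReal_exp]
  rw [← Complex.exp_sum, dotProduct, ← Finset.sum_neg_distrib]
  congr 1
  refine Finset.sum_congr rfl fun k _ => ?_
  rw [mulVec_diagonal, Pi.star_apply]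
  push_cast
  rw [← Complex.conj_mul']
  simp; ring

theorem integral_exp_neg_quadForm_diagonal {d : ι → ℝ} (hd : ∀ i, 0 ≤ d i) :
    ∫ g, Complex.exp (-(star g ⬝ᵥ diagonal (fun i => (d i : ℂ)) *ᵥ g)) ∂(gaussVec ι)
      = ∏ k, (1 + (d k : ℂ))⁻¹ := by
  simp_rw [exp_neg_quadForm_diagonal]
  rw [gaussVec, integral_fintype_prod_eq_prod
    (fun k (z : ℂ) => ((Real.exp (-(d k * ‖z‖ ^ 2)) : ℝ) : ℂ))]
  refine Finset.prod_congr rfl fun k _ => ?_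
  rw [integral_complex_ofReal, integral_exp_neg_mul_normSq_stdComplexGaussian (hd k)]
  push_cast; rfl

theorem integral_exp_neg_quadForm_diagonal_mul {d : ι → ℝ} (hd : ∀ i, 0 ≤ d i) (i j : ι) :
    ∫ g, Complex.exp (-(star g ⬝ᵥ diagonal (fun i => (d i : ℂ)) *ᵥ g)) * (g i * star (g j))
        ∂(gaussVec ι)
      = if i = j then (∏ k, (1 + (d k : ℂ))⁻¹) * (1 + (d i : ℂ))⁻¹ else 0 := by
  simp_rw [exp_neg_quadForm_diagonal]
  split_ifs with hij
  · subst hij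
    have h : ∀ g : ι → ℂ, (∏ k, ((Real.exp (-(d k * ‖g k‖ ^ 2)) : ℝ) : ℂ)) * (g i * star (g i))
        = ∏ k, ((Real.exp (-(d k * ‖g k‖ ^ 2)) * (if k = i then ‖g k‖ ^ 2 else 1) : ℝ) : ℂ) := by
      intro g
      push_cast
      rw [Finset.prod_mul_distrib]
      congr 1
      simp [Complex.mul_conj', apply_ite Complex.ofReal]
    simp_rw [h]
    rw [gaussVec, integral_fintype_prod_eq_prod (fun k (z : ℂ) =>
      ((Real.exp (-(d k * ‖z‖ ^ 2)) * (if k = i then ‖z‖ ^ 2 else 1) : ℝ) : ℂ))]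
    have h2 : ∀ k, ∫ z, ((Real.exp (-(d k * ‖z‖ ^ 2)) *
          (if k = i then ‖z‖ ^ 2 else 1) : ℝ) : ℂ) ∂stdComplexGaussian
        = (1 + (d k : ℂ))⁻¹ * (if k = i then (1 + (d k : ℂ))⁻¹ else 1) := by
      intro k
      rw [integral_complex_ofReal]
      split_ifs with hk
      · rw [integral_exp_neg_mul_normSq_mul_normSq_stdComplexGaussian (hd k)]; push_cast; rfl
      · simp only [mul_one]
        rw [integral_exp_neg_mul_normSq_stdComplexGaussian (hd k)]; push_cast; rfl
    simp_rw [h2]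
    rw [Finset.prod_mul_distrib]
    simp
  · -- the integrand is odd under the change of sign of the `i`-th coordinate
    let s : ι → ℂ := fun k => if k = i then -1 else 1
    have hU : diagonal s * star (diagonal s) = 1 := by
      rw [star_eq_conjTranspose, diagonal_conjTranspose, diagonal_mul_diagonal, ← diagonal_one]
      congr 1
      ext k
      by_cases hk : k = i <;> simp [s, hk]
    have hsi : s i = -1 := by simp [s]
    have hsj : s j = 1 := by simp [s, Ne.symm hij]
    have hn : ∀ k, ‖s k‖ = 1 := fun k => by by_cases hk : k = i <;> simp [s, hk]
    have hinv := (integral_gaussVec_unitary hU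
      (fun g : ι → ℂ => (∏ k, ((Real.exp (-(d k * ‖g k‖ ^ 2)) : ℝ) : ℂ)) * (g i * star (g j)))).symm
    simp only [mulVec_diagonal, norm_mul, hn, one_mul, hsi, hsj] at hinv
    have h3 : ∀ g : ι → ℂ, (∏ k, ((Real.exp (-(d k * ‖g k‖ ^ 2)) : ℝ) : ℂ)) *
        (-1 * g i * star (g j))
        = -((∏ k, ((Real.exp (-(d k * ‖g k‖ ^ 2)) : ℝ) : ℂ)) * (g i * star (g j))) := by
      intro g; ring
    simp_rw [h3] at hinv
    rw [integral_neg] at hinv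
    exact self_eq_neg.1 hinv.symm

open scoped ComplexOrder in
theorem Matrix.PosSemidef.exists_unitary_diagonal {W : Matrix ι ι ℂ} (hW : W.PosSemidef) :
    ∃ (U : Matrix ι ι ℂ) (d : ι → ℝ), U * star U = 1 ∧ (∀ i, 0 ≤ d i) ∧
      W = U * diagonal (fun i => (d i : ℂ)) * star U := by
  refine ⟨hW.isHermitian.eigenvectorUnitary, hW.isHermitian.eigenvalues, ?_,
    hW.eigenvalues_nonneg, ?_⟩
  · exact Unitary.coe_mul_star_self _
  · conv_lhs => rw [hW.isHermitian.spectral_theorem, Unitary.conjStarAlgAut_apply]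
    rfl

theorem quadForm_unitary {U : Matrix ι ι ℂ} (hU : U * star U = 1) (D : Matrix ι ι ℂ)
    (g : ι → ℂ) :
    star (U *ᵥ g) ⬝ᵥ (U * D * star U) *ᵥ (U *ᵥ g) = star g ⬝ᵥ D *ᵥ g := by
  rw [star_mulVec, mulVec_mulVec, ← dotProduct_mulVec, mulVec_mulVec, ← star_eq_conjTranspose]
  congr 2
  have h' := mul_eq_one_comm.1 hU
  calc star U * (U * D * star U * U) = (star U * U) * D * (star U * U) := by
        simp only [Matrix.mul_assoc]
    _ = D := by rw [h']; simp

theorem one_add_unitary_conj {U : Matrix ι ι ℂ} (hU : U * star U = 1) (d : ι → ℝ) :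
    1 + U * diagonal (fun i => (d i : ℂ)) * star U
      = U * diagonal (fun i => 1 + (d i : ℂ)) * star U := by
  have : diagonal (fun i => 1 + (d i : ℂ)) = 1 + diagonal (fun i => (d i : ℂ)) := by
    rw [← diagonal_one, diagonal_add]
  rw [this, Matrix.mul_add, Matrix.add_mul, Matrix.mul_one, hU]

theorem det_one_add_unitary_conj {U : Matrix ι ι ℂ} (hU : U * star U = 1) (d : ι → ℝ) :
    (1 + U * diagonal (fun i => (d i : ℂ)) * star U).det = ∏ i, (1 + (d i : ℂ)) := by
  rw [one_add_unitary_conj hU, det_mul_comm, ← Matrix.mul_assoc, mul_eq_one_comm.1 hU,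
    Matrix.one_mul, det_diagonal]

theorem one_add_ofReal_ne_zero {x : ℝ} (hx : 0 ≤ x) : (1 + (x : ℂ)) ≠ 0 := by
  have : (1 + (x : ℂ)) = ((1 + x : ℝ) : ℂ) := by push_cast; rfl
  rw [this, Ne, Complex.ofReal_eq_zero]; positivity

open scoped ComplexOrder in
/-- The reciprocal determinant as a Gaussian average. -/
theorem integral_exp_neg_quadForm {W : Matrix ι ι ℂ} (hW : W.PosSemidef) :
    ∫ h, Complex.exp (-(star h ⬝ᵥ W *ᵥ h)) ∂(gaussVec ι) = ((1 + W).det)⁻¹ := by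
  obtain ⟨U, d, hU, hd, rfl⟩ := hW.exists_unitary_diagonal
  rw [integral_gaussVec_unitary hU, det_one_add_unitary_conj hU]
  simp_rw [quadForm_unitary hU]
  rw [integral_exp_neg_quadForm_diagonal hd, Finset.prod_inv_distrib]

open scoped ComplexOrder in
/-- Weighting by `exp (-h† W h)` changes the covariance of a Gaussian vector from `1` to
`(1 + W)⁻¹`. -/
theorem integral_exp_neg_quadForm_mul {W : Matrix ι ι ℂ} (hW : W.PosSemidef) (i j : ι) :
    ∫ h, Complex.exp (-(star h ⬝ᵥ W *ᵥ h)) * (h i * star (h j)) ∂(gaussVec ι)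
      = ((1 + W).det)⁻¹ * (1 + W)⁻¹ i j := by
  obtain ⟨U, d, hU, hd, rfl⟩ := hW.exists_unitary_diagonal
  have hinv : (1 + U * diagonal (fun i => (d i : ℂ)) * star U)⁻¹
      = U * diagonal (fun i => (1 + (d i : ℂ))⁻¹) * star U := by
    refine Matrix.inv_eq_right_inv ?_
    rw [one_add_unitary_conj hU]
    calc _ = U * diagonal (fun i => 1 + (d i : ℂ)) * (star U * U) *
          diagonal (fun i => (1 + (d i : ℂ))⁻¹) * star U := by simp only [Matrix.mul_assoc]
      _ = 1 := by
        rw [mul_eq_one_comm.1 hU, Matrix.mul_one, Matrix.mul_assoc U, diagonal_mul_diagonal]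
        simp_rw [mul_inv_cancel₀ (one_add_ofReal_ne_zero (hd _))]
        rw [diagonal_one, Matrix.mul_one, hU]
  rw [integral_gaussVec_unitary hU, det_one_add_unitary_conj hU, hinv]
  simp_rw [quadForm_unitary hU]
  have hexp : HasAllMoments (fun g : ι → ℂ =>
      Complex.exp (-(star g ⬝ᵥ diagonal (fun i => (d i : ℂ)) *ᵥ g))) (gaussVec ι) := by
    refine HasAllMoments.of_bound (Continuous.aestronglyMeasurable (by fun_prop)) 1 fun g => ?_
    rw [exp_neg_quadForm_diagonal, ← Complex.ofReal_prod, Complex.norm_real, Real.norm_eq_abs,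
      Finset.abs_prod]
    refine Finset.prod_le_one (fun _ _ => abs_nonneg _) fun k _ => ?_
    rw [Real.abs_exp]
    exact Real.exp_le_one_iff.2 (by have := mul_nonneg (hd k) (sq_nonneg ‖g k‖); linarith)
  have hsum : ∀ g : ι → ℂ, Complex.exp (-(star g ⬝ᵥ diagonal (fun i => (d i : ℂ)) *ᵥ g)) *
        ((U *ᵥ g) i * star ((U *ᵥ g) j))
      = ∑ k, ∑ l, U i k * star (U j l) *
        (Complex.exp (-(star g ⬝ᵥ diagonal (fun i => (d i : ℂ)) *ᵥ g)) * (g k * star (g l))) := by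
    intro g
    generalize Complex.exp (-(star g ⬝ᵥ diagonal (fun i => (d i : ℂ)) *ᵥ g)) = e
    have h1 : ∀ i, (U *ᵥ g) i = ∑ k, U i k * g k := fun i => rfl
    rw [h1, h1, star_sum, Finset.sum_mul_sum, Finset.mul_sum]
    refine Finset.sum_congr rfl fun k _ => ?_
    rw [Finset.mul_sum]
    refine Finset.sum_congr rfl fun l _ => ?_
    rw [star_mul']; ring
  simp_rw [hsum]
  have hint : ∀ k l, Integrable (fun g : ι → ℂ => U i k * star (U j l) *
      (Complex.exp (-(star g ⬝ᵥ diagonal (fun i => (d i : ℂ)) *ᵥ g)) * (g k * star (g l))))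
      (gaussVec ι) := fun k l =>
    (hexp.mul ((hasAllMoments_gaussVec k).mul (hasAllMoments_gaussVec l).star)).integrable.const_mul
      _
  rw [integral_finsetSum _ fun k _ => integrable_finsetSum _ fun l _ => hint k l,
    Matrix.mul_apply, Finset.mul_sum]
  refine Finset.sum_congr rfl fun k _ => ?_
  rw [integral_finsetSum _ fun l _ => hint k l, mul_diagonal, star_apply]
  simp_rw [integral_const_mul, integral_exp_neg_quadForm_diagonal_mul hd]
  rw [Finset.sum_eq_single k]
  · simp [Finset.prod_inv_distrib]; ring
  · intro l _ hl; simp [hl.symm]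
  · simp

end gaussVec

/-! ### The mean ratio of two Wishart determinants -/

section tilt

variable {ι : Type*} [Fintype ι]

theorem det_smul_one_add_vecMulVec [DecidableEq ι] (c a : ℂ) (v : ι → ℂ) :
    (c • (1 : Matrix ι ι ℂ) + a • vecMulVec v (star v)).det
      = c ^ Fintype.card ι + c ^ (Fintype.card ι - 1) * (a * ((∑ i, ‖v i‖ ^ 2 : ℝ) : ℂ)) := by
  have h : (vecMulVec v (star v)).trace = ((∑ i, ‖v i‖ ^ 2 : ℝ) : ℂ) := by
    rw [Matrix.trace]
    push_cast
    refine Finset.sum_congr rfl fun i _ => ?_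
    simp [vecMulVec_apply, Complex.mul_conj']
  have e : a • vecMulVec v (star v) = vecMulVec (a • v) (star v) := by
    rw [smul_vecMulVec]
  rw [e, det_add_vecMulVec_eq_add_trace, det_smul, det_one, mul_one, adjugate_smul, adjugate_one,
    ← e, Matrix.smul_mul, Matrix.one_mul, trace_smul, trace_smul, h]
  simp

theorem det_one_add_smul_vecMulVec [DecidableEq ι] (a : ℝ) (v : ι → ℂ) :
    (1 + (a : ℂ) • vecMulVec v (star v)).det = ((1 + a * ∑ i, ‖v i‖ ^ 2 : ℝ) : ℂ) := by
  have := det_smul_one_add_vecMulVec 1 (a : ℂ) v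
  rw [one_smul] at this
  rw [this]; push_cast; simp

open scoped ComplexOrder in
theorem posSemidef_smul_vecMulVec {a : ℝ} (ha : 0 ≤ a) (v : ι → ℂ) :
    ((a : ℂ) • vecMulVec v (star v)).PosSemidef :=
  (posSemidef_vecMulVec_self_star v).smul (by exact_mod_cast ha)

open Polynomial in
/-- The covariance `(1 + a v v†)⁻¹` has the eigenvalue `(1 + a ‖v‖²)⁻¹` once and `1` otherwise. -/
theorem detPencil_tilted_covariance [DecidableEq ι] [Nonempty ι] {a : ℝ} (ha : 0 ≤ a) (β : ℂ)
    (v : ι → ℂ) :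
    detPencil (β • (1 + (a : ℂ) • vecMulVec v (star v))⁻¹) 1
      = (1 + C β * X) ^ (Fintype.card ι - 1)
        * (1 + C (β * ((1 + a * ∑ i, ‖v i‖ ^ 2 : ℝ) : ℂ)⁻¹) * X) := by
  set D : ℝ := 1 + a * ∑ i, ‖v i‖ ^ 2 with hD
  have hDpos : 0 < D := by positivity
  have hD0 : (D : ℂ) ≠ 0 := by exact_mod_cast hDpos.ne'
  set W := (a : ℂ) • vecMulVec v (star v) with hW
  have hdet : (1 + W).det = (D : ℂ) := det_one_add_smul_vecMulVec a v
  have hu : IsUnit (1 + W).det := by rw [hdet]; exact isUnit_iff_ne_zero.2 hD0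
  refine Polynomial.funext fun t => ?_
  rw [detPencil_eval]
  have h1 : (t • β • (1 + W)⁻¹ + 1).det * (1 + W).det
      = ((1 + t * β) • (1 : Matrix ι ι ℂ) + W).det := by
    rw [← det_mul, Matrix.add_mul, smul_mul, smul_mul, nonsing_inv_mul _ hu, Matrix.one_mul,
      smul_smul, add_smul, one_smul]
    congr 1; abel
  rw [hdet, hW, det_smul_one_add_vecMulVec] at h1
  rw [eq_div_of_mul_eq hD0 h1]
  obtain ⟨q, hq⟩ : ∃ q, Fintype.card ι = q + 1 :=
    ⟨Fintype.card ι - 1, by have := Fintype.card_pos (α := ι); omega⟩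
  have hs : (a : ℂ) * ((∑ i, ‖v i‖ ^ 2 : ℝ) : ℂ) = D - 1 := by rw [hD]; push_cast; ring
  rw [hs, hq]
  simp only [Nat.add_sub_cancel, eval_mul, eval_pow, eval_add, eval_one, eval_C, eval_X]
  field_simp
  ring

theorem hasAllMoments_exp_neg_quadForm_rankOne [DecidableEq ι] {a : ℝ} (ha : 0 ≤ a) (v : ι → ℂ) :
    HasAllMoments (fun h : ι → ℂ =>
      Complex.exp (-(star h ⬝ᵥ ((a : ℂ) • vecMulVec v (star v)) *ᵥ h))) (gaussVec ι) := by
  refine HasAllMoments.of_bound (Continuous.aestronglyMeasurable (by fun_prop)) 1 fun g => ?_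
  rw [Complex.norm_exp]
  refine Real.exp_le_one_iff.2 ?_
  have := (posSemidef_smul_vecMulVec ha v).re_dotProduct_nonneg g
  simpa using this

/-- For a fixed vector `v` the weight `exp (-a |v† h|²)` on each column `h` turns `H` into a
Gaussian matrix with column covariance `(1 + a v v†)⁻¹`. -/
theorem integral_tilted_det [DecidableEq ι] [Nonempty ι] {a : ℝ} (ha : 0 ≤ a) (β : ℂ)
    (v : ι → ℂ) (n : ℕ) :
    ∫ h : Fin n → ι → ℂ,
        (∏ j, Complex.exp (-(star (h j) ⬝ᵥ ((a : ℂ) • vecMulVec v (star v)) *ᵥ h j))) *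
        (1 + β • ∑ j, vecMulVec (h j) (star (h j))).det ∂(Measure.pi fun _ => gaussVec ι)
      = (((1 + a * ∑ i, ‖v i‖ ^ 2 : ℝ) : ℂ)⁻¹) ^ n * fallingPairing ℂ n
          ((1 + Polynomial.C β * Polynomial.X) ^ (Fintype.card ι - 1)
            * (1 + Polynomial.C (β * ((1 + a * ∑ i, ‖v i‖ ^ 2 : ℝ) : ℂ)⁻¹) * Polynomial.X)) := by
  have hpsd := posSemidef_smul_vecMulVec ha v
  have hdet := det_one_add_smul_vecMulVec a v
  have hM := integral_exp_neg_quadForm_mul hpsd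
  have h1 := integral_exp_neg_quadForm hpsd
  have hmom := hasAllMoments_exp_neg_quadForm_rankOne ha v
  rw [← detPencil_tilted_covariance ha]
  set D : ℝ := 1 + a * ∑ i, ‖v i‖ ^ 2 with hD
  have hDpos : 0 < D := by positivity
  have hD0 : (D : ℂ) ≠ 0 := by exact_mod_cast hDpos.ne'
  set W := (a : ℂ) • vecMulVec v (star v) with hW
  rw [hdet] at h1 hM
  have key := integral_prod_weight_mul_det_add_sum (gaussVec ι)
    (w := fun h => (D : ℂ) * Complex.exp (-(star h ⬝ᵥ W *ᵥ h)))
    ((HasAllMoments.const _).mul hmom) hasAllMoments_gaussVec (M := (1 + W)⁻¹)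
    (by rw [integral_const_mul, h1, mul_inv_cancel₀ hD0])
    (fun i j => by
      simp_rw [mul_assoc]
      rw [integral_const_mul, hM, ← mul_assoc, mul_inv_cancel₀ hD0, one_mul]) n 1
    (β • (1 : Matrix ι ι ℂ)) 1
  simp only [Matrix.mul_one, smul_mul, Matrix.one_mul, Finset.prod_mul_distrib,
    Finset.prod_const, Finset.card_univ, Fintype.card_fin, mul_assoc] at key
  rw [integral_const_mul] at key
  rw [← key, ← mul_assoc, ← mul_pow, inv_mul_cancel₀ hD0, one_pow, one_mul]

end tilt

section resolvent

variable {ι : Type*} [Fintype ι]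

/-- The negative moments `E (1 + a ‖v‖²)⁻ᴺ` of a standard Gaussian vector `v`. -/
noncomputable def gaussNegMoment (ι : Type*) [Fintype ι] (a : ℝ) (N : ℕ) : ℝ :=
  ∫ v : ι → ℂ, ((1 + a * ∑ i, ‖v i‖ ^ 2)⁻¹) ^ N ∂(gaussVec ι)

theorem integrable_gaussNegMoment {a : ℝ} (ha : 0 ≤ a) (N : ℕ) :
    Integrable (fun v : ι → ℂ => ((1 + a * ∑ i, ‖v i‖ ^ 2)⁻¹) ^ N) (gaussVec ι) := by
  refine Integrable.of_bound (Measurable.aestronglyMeasurable (by measurability)) 1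
    (Filter.Eventually.of_forall fun v => ?_)
  have h : 1 ≤ 1 + a * ∑ i, ‖v i‖ ^ 2 := by
    have : 0 ≤ a * ∑ i, ‖v i‖ ^ 2 := by positivity
    linarith
  rw [Real.norm_of_nonneg (by positivity)]
  exact pow_le_one₀ (by positivity) (inv_le_one_of_one_le₀ h)

open scoped ComplexOrder in
theorem posSemidef_sum_vecMulVec {n : ℕ} (h : Fin n → ι → ℂ) :
    (∑ j, vecMulVec (h j) (star (h j))).PosSemidef :=
  posSemidef_sum _ fun _ _ => posSemidef_vecMulVec_self_star _

theorem star_dotProduct_vecMulVec_mulVec (v h : ι → ℂ) :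
    star v ⬝ᵥ vecMulVec h (star h) *ᵥ v = star h ⬝ᵥ vecMulVec v (star v) *ᵥ h := by
  rw [vecMulVec_mulVec, vecMulVec_mulVec, dotProduct_smul, dotProduct_smul]
  simp [mul_comm]

open scoped ComplexOrder in
/-- The mean of `det (1 + β W) / det (1 + a W)` over the Wishart matrix `W = ∑ⱼ hⱼ hⱼ†`. The
denominator is written as the Gaussian integral
`det (1 + a W)⁻¹ = E exp (-a v† W v)`; for fixed `v` the average over `W` is elementary. -/
theorem integral_det_div_det [DecidableEq ι] [Nonempty ι] {a : ℝ} (ha : 0 ≤ a) (β : ℂ) (n : ℕ) :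
    ∫ h : Fin n → ι → ℂ, (1 + β • ∑ j, vecMulVec (h j) (star (h j))).det /
        (1 + (a : ℂ) • ∑ j, vecMulVec (h j) (star (h j))).det ∂(Measure.pi fun _ => gaussVec ι)
      = (gaussNegMoment ι a n : ℂ) * fallingPairing ℂ n
          ((1 + Polynomial.C β * Polynomial.X) ^ (Fintype.card ι - 1))
        + (gaussNegMoment ι a (n + 1) : ℂ) * fallingPairing ℂ n
          ((1 + Polynomial.C β * Polynomial.X) ^ (Fintype.card ι - 1) *
            (Polynomial.C β * Polynomial.X)) := by
  have hexp : ∀ (h : Fin n → ι → ℂ) (v : ι → ℂ),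
      Complex.exp (-(star v ⬝ᵥ ((a : ℂ) • ∑ j, vecMulVec (h j) (star (h j))) *ᵥ v))
        = ∏ j, Complex.exp (-(star (h j) ⬝ᵥ ((a : ℂ) • vecMulVec v (star v)) *ᵥ h j)) := by
    intro h v
    rw [← Complex.exp_sum]
    congr 1
    rw [smul_mulVec, sum_mulVec, dotProduct_smul, dotProduct_sum, Finset.smul_sum,
      Finset.sum_neg_distrib]
    congr 1
    refine Finset.sum_congr rfl fun j _ => ?_
    rw [star_dotProduct_vecMulVec_mulVec, smul_mulVec, dotProduct_smul]
  have hbound : ∀ (h : Fin n → ι → ℂ) (v : ι → ℂ),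
      ‖Complex.exp (-(star v ⬝ᵥ ((a : ℂ) • ∑ j, vecMulVec (h j) (star (h j))) *ᵥ v))‖ ≤ 1 := by
    intro h v
    rw [hexp, norm_prod]
    refine Finset.prod_le_one (fun _ _ => norm_nonneg _) fun j _ => ?_
    rw [Complex.norm_exp]
    refine Real.exp_le_one_iff.2 ?_
    simpa using (posSemidef_smul_vecMulVec ha v).re_dotProduct_nonneg (h j)
  have hden : ∀ h : Fin n → ι → ℂ,
      (1 + β • ∑ j, vecMulVec (h j) (star (h j))).det /
        (1 + (a : ℂ) • ∑ j, vecMulVec (h j) (star (h j))).det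
      = ∫ v, Complex.exp (-(star v ⬝ᵥ ((a : ℂ) • ∑ j, vecMulVec (h j) (star (h j))) *ᵥ v)) *
          (1 + β • ∑ j, vecMulVec (h j) (star (h j))).det ∂(gaussVec ι) := by
    intro h
    rw [integral_mul_const, integral_exp_neg_quadForm
      ((posSemidef_sum_vecMulVec h).smul (by exact_mod_cast ha)), div_eq_mul_inv, mul_comm]
  simp_rw [hden]
  have hnum : HasAllMoments (fun h : Fin n → ι → ℂ =>
      (1 + β • ∑ j, vecMulVec (h j) (star (h j))).det) (Measure.pi fun _ => gaussVec ι) :=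
    MatrixHasAllMoments.det ((MatrixHasAllMoments.const _).add ((MatrixHasAllMoments.sum _
      fun j _ => MatrixHasAllMoments.vecMulVec_star fun i =>
        (hasAllMoments_gaussVec i).comp_measurePreserving (measurePreserving_eval _ j)).smul β))
  rw [integral_integral_swap]
  swap
  · have h1 := hnum.integrable.comp_fst (gaussVec ι)
    refine h1.bdd_mul (c := 1) (Continuous.aestronglyMeasurable ?_)
      (Filter.Eventually.of_forall fun x => hbound x.1 x.2)
    fun_prop
  simp_rw [hexp, integral_tilted_det ha]
  have hlin : ∀ T : ℂ, fallingPairing ℂ n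
      ((1 + Polynomial.C β * Polynomial.X) ^ (Fintype.card ι - 1)
            * (1 + Polynomial.C (β * T) * Polynomial.X))
      = fallingPairing ℂ n ((1 + Polynomial.C β * Polynomial.X) ^ (Fintype.card ι - 1))
        + T * fallingPairing ℂ n
          ((1 + Polynomial.C β * Polynomial.X) ^ (Fintype.card ι - 1) *
            (Polynomial.C β * Polynomial.X)) := by
    intro T
    rw [← smul_eq_mul T, ← map_smul, ← map_add, Polynomial.smul_eq_C_mul, Polynomial.C_mul]
    congr 1; ring
  simp_rw [hlin, mul_add]
  have hi : ∀ N, Integrable (fun v : ι → ℂ =>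
      ((((1 + a * ∑ i, ‖v i‖ ^ 2)⁻¹) ^ N : ℝ) : ℂ)) (gaussVec ι) :=
    fun N => (integrable_gaussNegMoment ha N).ofReal
  have hpow : ∀ (x : ℝ) (N : ℕ), ((x : ℂ)⁻¹) ^ N = (((x⁻¹) ^ N : ℝ) : ℂ) := by
    intro x N; push_cast; rfl
  simp_rw [← mul_assoc, ← pow_succ, hpow]
  rw [integral_add ((hi n).mul_const _) ((hi (n + 1)).mul_const _), integral_mul_const,
    integral_mul_const, integral_complex_ofReal, integral_complex_ofReal]
  rfl

theorem integral_exp_neg_mul_sum_normSq {t : ℝ} (ht : 0 ≤ t) :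
    ∫ v : ι → ℂ, Real.exp (-(t * ∑ i, ‖v i‖ ^ 2)) ∂(gaussVec ι)
      = ((1 + t)⁻¹) ^ Fintype.card ι := by
  have h : ∀ v : ι → ℂ, Real.exp (-(t * ∑ i, ‖v i‖ ^ 2)) = ∏ i, Real.exp (-(t * ‖v i‖ ^ 2)) := by
    intro v
    rw [← Real.exp_sum, Finset.mul_sum, Finset.sum_neg_distrib]
  simp_rw [h]
  rw [gaussVec, integral_fintype_prod_eq_pow (fun z : ℂ => Real.exp (-(t * ‖z‖ ^ 2))),
    integral_exp_neg_mul_normSq_stdComplexGaussian ht]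

theorem integrableOn_pow_mul_exp_neg (N : ℕ) :
    IntegrableOn (fun t : ℝ => t ^ N * Real.exp (-t)) (Set.Ioi 0) := by
  have := Real.GammaIntegral_convergent (s := (N : ℝ) + 1) (by positivity)
  refine this.congr_fun (fun t _ => ?_) measurableSet_Ioi
  simp only [add_sub_cancel_right, Real.rpow_natCast]
  ring

theorem integral_pow_mul_exp_neg_mul (N : ℕ) {r : ℝ} (hr : 0 < r) :
    ∫ t in Set.Ioi (0 : ℝ), t ^ N * Real.exp (-(r * t)) = N.factorial * (r⁻¹) ^ (N + 1) := by
  have := Real.integral_rpow_mul_exp_neg_mul_Ioi (a := (N : ℝ) + 1) (by positivity) hr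
  simp only [add_sub_cancel_right, Real.rpow_natCast] at this
  rw [this, Real.Gamma_nat_eq_factorial, one_div, mul_comm]
  congr 1
  exact_mod_cast Real.rpow_natCast _ (N + 1)

/-- The negative moments of `1 + a ‖v‖²` as one-dimensional integrals (a form of Kummer's
transformation of the confluent hypergeometric function). -/
theorem factorial_mul_gaussNegMoment {a : ℝ} (ha : 0 ≤ a) (N : ℕ) :
    (N.factorial : ℝ) * gaussNegMoment ι a (N + 1)
      = ∫ t in Set.Ioi (0 : ℝ), t ^ N * Real.exp (-t) * ((1 + a * t)⁻¹) ^ Fintype.card ι := by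
  have h1 : ∀ v : ι → ℂ, (N.factorial : ℝ) * ((1 + a * ∑ i, ‖v i‖ ^ 2)⁻¹) ^ (N + 1)
      = ∫ t in Set.Ioi (0 : ℝ), Real.exp (-(a * t * ∑ i, ‖v i‖ ^ 2)) *
          (t ^ N * Real.exp (-t)) := by
    intro v
    -- Euler's integral for a negative power
    rw [← integral_pow_mul_exp_neg_mul N (by positivity)]
    refine integral_congr_ae (Filter.Eventually.of_forall fun t => ?_)
    simp only
    rw [mul_comm (Real.exp _), mul_assoc, ← Real.exp_add]
    congr 2; ring
  rw [gaussNegMoment, ← integral_const_mul]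
  simp_rw [h1]
  rw [integral_integral_swap]
  · refine setIntegral_congr_fun measurableSet_Ioi fun t ht => ?_
    rw [integral_mul_const, integral_exp_neg_mul_sum_normSq (mul_nonneg ha (le_of_lt ht)),
      mul_comm]
  · have h2 := (integrableOn_pow_mul_exp_neg N).integrable.comp_snd (gaussVec ι)
    refine h2.bdd_mul (c := 1) (Continuous.aestronglyMeasurable (by fun_prop)) ?_
    have h3 : ∀ᵐ x : (ι → ℂ) × ℝ ∂((gaussVec ι).prod (volume.restrict (Set.Ioi 0))), 0 < x.2 :=
      Measure.quasiMeasurePreserving_snd.ae (ae_restrict_mem measurableSet_Ioi)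
    filter_upwards [h3] with x hx
    rw [Real.norm_eq_abs, Real.abs_exp]
    refine Real.exp_le_one_iff.2 ?_
    have : 0 ≤ a * x.2 * ∑ i, ‖x.1 i‖ ^ 2 := by positivity
    linarith

end resolvent

/-! ### The mean ratio as a polynomial -/

section ratioPoly
open Polynomial

/-- The polynomial `∑ₖ n (n - 1) ⋯ (n - k + 1) Qₖ Xᵏ`. -/
noncomputable def fallingTransform {R : Type*} [CommRing R] (n : ℕ) (Q : R[X]) : R[X] :=
  ∑ k ∈ Finset.range (Q.natDegree + 1), monomial k ((n.descFactorial k : R) * Q.coeff k)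

variable {R : Type*} [CommRing R]

theorem fallingTransform_coeff (n : ℕ) (Q : R[X]) (k : ℕ) :
    (fallingTransform n Q).coeff k = (n.descFactorial k : R) * Q.coeff k := by
  rw [fallingTransform, finsetSum_coeff]
  simp only [coeff_monomial]
  rw [Finset.sum_ite_eq']
  split_ifs with h
  · rfl
  · rw [coeff_eq_zero_of_natDegree_lt (by simpa using h), mul_zero]

theorem fallingTransform_natDegree_le (n : ℕ) (Q : R[X]) :
    (fallingTransform n Q).natDegree ≤ Q.natDegree := by
  refine natDegree_le_iff_coeff_eq_zero.2 fun N hN => ?_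
  rw [fallingTransform_coeff, coeff_eq_zero_of_natDegree_lt hN, mul_zero]

theorem fallingTransform_eval (n : ℕ) (Q : R[X]) (β : R) :
    (fallingTransform n Q).eval β = fallingPairing R n (Q.comp (C β * X)) := by
  have hdeg : (Q.comp (C β * X)).natDegree < Q.natDegree + 1 := by
    refine Nat.lt_succ_of_le (natDegree_le_iff_coeff_eq_zero.2 fun N hN => ?_)
    rw [comp_C_mul_X_coeff, coeff_eq_zero_of_natDegree_lt hN, zero_mul]
  rw [fallingPairing_eq_sum_range n _ _ hdeg, fallingTransform, eval_finsetSum]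
  refine Finset.sum_congr rfl fun k _ => ?_
  rw [eval_monomial, comp_C_mul_X_coeff, mul_assoc]

theorem fallingTransform_map {S : Type*} [CommRing S] (f : R →+* S) (n : ℕ) (Q : R[X]) :
    (fallingTransform n Q).map f = fallingTransform n (Q.map f) := by
  ext k
  simp [fallingTransform_coeff, coeff_map]

/-- `E det (1 + β W) / det (1 + a W)` as a polynomial in `β`, where `W = H H†` and `H` is a
`q × p` matrix of independent `CN(0,1)` variables. -/
noncomputable def wishartRatioPoly (p q : ℕ) (a : ℝ) : ℝ[X] :=
  fallingTransform p ((1 + X) ^ (q - 1) *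
    (C (gaussNegMoment (Fin q) a p) + C (gaussNegMoment (Fin q) a (p + 1)) * X))

theorem wishartRatioPoly_natDegree_le {q : ℕ} (hq : 1 ≤ q) (p : ℕ) (a : ℝ) :
    (wishartRatioPoly p q a).natDegree ≤ q := by
  refine (fallingTransform_natDegree_le _ _).trans ?_
  refine natDegree_mul_le.trans ?_
  have h1 : ((1 + X : ℝ[X]) ^ (q - 1)).natDegree ≤ q - 1 := by
    refine natDegree_pow_le.trans ?_
    have : (1 + X : ℝ[X]).natDegree ≤ 1 := by compute_degree
    nlinarith
  have h2 : (C (gaussNegMoment (Fin q) a p) + C (gaussNegMoment (Fin q) a (p + 1)) * X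
      : ℝ[X]).natDegree ≤ 1 := by compute_degree
  omega

theorem integral_det_div_det_eq_eval {q : ℕ} (hq : 1 ≤ q) {a : ℝ} (ha : 0 ≤ a) (β : ℂ) (p : ℕ) :
    ∫ h : Fin p → Fin q → ℂ, (1 + β • ∑ j, vecMulVec (h j) (star (h j))).det /
        (1 + (a : ℂ) • ∑ j, vecMulVec (h j) (star (h j))).det
        ∂(Measure.pi fun _ => gaussVec (Fin q))
      = ((wishartRatioPoly p q a).map Complex.ofRealHom).eval β := by
  have : Nonempty (Fin q) := ⟨⟨0, hq⟩⟩
  rw [integral_det_div_det ha, wishartRatioPoly, fallingTransform_map, fallingTransform_eval,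
    Fintype.card_fin, ← smul_eq_mul (gaussNegMoment _ _ _ : ℂ),
    ← smul_eq_mul (gaussNegMoment _ _ (p + 1) : ℂ), ← map_smul, ← map_smul, ← map_add]
  congr 1
  simp only [smul_eq_C_mul, Polynomial.map_mul, Polynomial.map_pow, Polynomial.map_add,
    Polynomial.map_one, map_X, map_C, Complex.ofRealHom_eq_coe, mul_comp, pow_comp, add_comp,
    one_comp, X_comp, C_comp]
  ring

end ratioPoly

/-! ### Averaging over the two hops -/

section model

theorem measurePreserving_curry_gaussVec (n r : ℕ) :
    MeasurePreserving (fun (x : Fin n × Fin r → ℂ) i j => x (i, j))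
      (Measure.pi fun _ => stdComplexGaussian) (Measure.pi fun _ => gaussVec (Fin r)) := by
  refine ⟨by fun_prop, ?_⟩
  have := Measure.infinitePi_map_curry (fun (_ : Fin n) (_ : Fin r) => stdComplexGaussian)
  simp only [Measure.infinitePi_eq_pi] at this
  exact this

theorem measurePreserving_curry_swap_gaussVec (n r : ℕ) :
    MeasurePreserving (fun (x : Fin n × Fin r → ℂ) j i => x (i, j))
      (Measure.pi fun _ => stdComplexGaussian) (Measure.pi fun _ => gaussVec (Fin n)) := by
  have h1 := measurePreserving_piCongrLeft
    (fun _ : Fin r × Fin n => stdComplexGaussian) (Equiv.prodComm (Fin n) (Fin r))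
  convert (measurePreserving_curry_gaussVec r n).comp h1 using 1
  ext x j i
  exact (Equiv.piCongrLeft_apply_apply (fun _ => ℂ) (Equiv.prodComm (Fin n) (Fin r)) x
    (i, j)).symm

/-- The joint law of the entries of the two channel matrices. -/
theorem IsRayleighDualHop.hasLaw {Ω : Type*} [MeasurableSpace Ω] {μ : Measure Ω}
    [IsProbabilityMeasure μ] {ns nr nd : ℕ}
    {H₁ : Ω → Matrix (Fin nr) (Fin ns) ℂ} {H₂ : Ω → Matrix (Fin nd) (Fin nr) ℂ}
    (hH : IsRayleighDualHop μ H₁ H₂) :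
    HasLaw (fun ω => ((fun e => H₁ ω e.1 e.2 : Fin nr × Fin ns → ℂ),
        (fun e => H₂ ω e.1 e.2 : Fin nd × Fin nr → ℂ)))
      ((Measure.pi fun _ => stdComplexGaussian).prod (Measure.pi fun _ => stdComplexGaussian))
      μ := by
  have hlaw : ∀ e, HasLaw (Sum.elim (fun (e : Fin nr × Fin ns) ω => H₁ ω e.1 e.2)
      (fun (e : Fin nd × Fin nr) ω => H₂ ω e.1 e.2) e) stdComplexGaussian μ := by
    rintro (e | e)
    · exact hH.law_fst e.1 e.2
    · exact hH.law_snd e.1 e.2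
  have h := (iIndepFun_iff_map_fun_eq_pi_map fun e => (hlaw e).aemeasurable).1 hH.indep
  simp only [(hlaw _).map_eq] at h
  have hmp := measurePreserving_sumPiEquivProdPi
    (fun _ : (Fin nr × Fin ns) ⊕ (Fin nd × Fin nr) => stdComplexGaussian)
  have h3 : HasLaw (fun ω e => Sum.elim (fun (e : Fin nr × Fin ns) ω => H₁ ω e.1 e.2)
      (fun (e : Fin nd × Fin nr) ω => H₂ ω e.1 e.2) e ω)
      (Measure.pi fun _ => stdComplexGaussian) μ :=
    ⟨aemeasurable_pi_lambda _ fun e => (hlaw e).aemeasurable, h⟩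
  exact hmp.hasLaw.comp h3

theorem mul_conjTranspose_eq_sum_vecMulVec {m n : Type*} [Fintype n] (A : Matrix m n ℂ) :
    A * Aᴴ = ∑ j, vecMulVec (fun i => A i j) (star fun i => A i j) := by
  ext i k
  simp [Matrix.mul_apply, Matrix.sum_apply, vecMulVec_apply]

/-- Averaging over the first hop. -/
theorem integral_det_firstHop {ns nr nd : ℕ} (a c : ℝ) (B : Matrix (Fin nd) (Fin nr) ℂ) :
    ∫ x : Fin nr × Fin ns → ℂ, (1 + (a : ℂ) • (B * Bᴴ) +
        (c : ℂ) • (B * (of fun i j => x (i, j)) * (of fun i j => x (i, j))ᴴ * Bᴴ)).det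
        ∂(Measure.pi fun _ => stdComplexGaussian)
      = fallingPairing ℂ ns (detPencil ((c : ℂ) • (B * Bᴴ)) (1 + (a : ℂ) • (B * Bᴴ))) := by
  have hcov : ∀ i j : Fin nr, ∫ h : Fin nr → ℂ, 1 * (h i * star (h j)) ∂(gaussVec (Fin nr))
      = (1 : Matrix (Fin nr) (Fin nr) ℂ) i j := by
    intro i j
    have := integral_exp_neg_quadForm_diagonal_mul (d := fun _ : Fin nr => 0) (by simp) i j
    simpa [Matrix.one_apply] using this
  have key := integral_prod_weight_mul_det_add_sum (gaussVec (Fin nr)) (w := fun _ => 1)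
    (HasAllMoments.const 1) hasAllMoments_gaussVec (M := 1) (by simp) hcov ns
    (1 + (a : ℂ) • (B * Bᴴ)) ((c : ℂ) • B) Bᴴ
  simp only [Finset.prod_const_one, one_mul, Matrix.mul_one, smul_mul] at key
  rw [← key, ← (measurePreserving_curry_swap_gaussVec nr ns).map_eq, integral_map]
  · refine integral_congr_ae (Filter.Eventually.of_forall fun x => ?_)
    simp only [Matrix.mul_assoc B, mul_conjTranspose_eq_sum_vecMulVec (of fun i j => x (i, j)),
      of_apply]
  · exact (measurePreserving_curry_swap_gaussVec nr ns).measurable.aemeasurable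
  · refine Continuous.aestronglyMeasurable (by fun_prop)

/-- Averaging over the second hop. Since `B B†` and `B† B` have the same non-zero spectrum, the
smaller of the two Gram matrices can be used. -/
theorem integral_det_div_det_secondHop {nr nd : ℕ} (hnr : 1 ≤ nr) (hnd : 1 ≤ nd) {a : ℝ}
    (ha : 0 ≤ a) (β : ℂ) :
    ∫ y : Fin nd × Fin nr → ℂ,
        (1 + β • ((of fun i j => y (i, j) : Matrix (Fin nd) (Fin nr) ℂ) *
          (of fun i j => y (i, j))ᴴ)).det /
        (1 + (a : ℂ) • ((of fun i j => y (i, j) : Matrix (Fin nd) (Fin nr) ℂ) *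
          (of fun i j => y (i, j))ᴴ)).det
        ∂(Measure.pi fun _ => stdComplexGaussian)
      = ((wishartRatioPoly (max nd nr) (min nd nr) a).map Complex.ofRealHom).eval β := by
  have hmeas : ∀ (m n : ℕ) (β : ℂ), Measurable fun h : Fin n → Fin m → ℂ =>
      (1 + β • ∑ j, vecMulVec (h j) (star (h j))).det := fun m n β =>
    Continuous.measurable (by fun_prop)
  rcases le_total nd nr with h | h
  · rw [max_eq_right h, min_eq_left h, ← integral_det_div_det_eq_eval hnd ha,
      ← (measurePreserving_curry_swap_gaussVec nd nr).map_eq, integral_map]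
    · simp only [mul_conjTranspose_eq_sum_vecMulVec, of_apply]
    · exact (measurePreserving_curry_swap_gaussVec nd nr).measurable.aemeasurable
    · exact ((hmeas _ _ _).div (hmeas _ _ _)).aestronglyMeasurable
  · rw [max_eq_left h, min_eq_right h, ← integral_det_div_det_eq_eval hnr ha,
      ← (measurePreserving_curry_gaussVec nd nr).map_eq, integral_map]
    · have hT : ∀ (β : ℂ) (B : Matrix (Fin nd) (Fin nr) ℂ), (1 + β • (B * Bᴴ)).det
          = (1 + β • ∑ j, vecMulVec (B j) (star (B j))).det := by
        intro β B
        have h2 := mul_conjTranspose_eq_sum_vecMulVec Bᵀ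
        simp only [transpose_apply] at h2
        change _ = (1 + β • ∑ j, vecMulVec (fun i => B j i) (star fun i => B j i)).det
        rw [← h2, ← smul_mul, det_one_add_mul_comm, ← det_transpose (1 + β • (Bᵀ * Bᵀᴴ))]
        congr 1
        rw [transpose_add, transpose_one, transpose_smul, transpose_mul, transpose_transpose,
          conjTranspose_transpose_eq_transpose_conjTranspose, transpose_transpose, Matrix.mul_smul]
      simp only [hT]
      rfl
    · exact (measurePreserving_curry_gaussVec nd nr).measurable.aemeasurable
    · exact ((hmeas _ _ _).div (hmeas _ _ _)).aestronglyMeasurable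

end model

/-! ### The mean of `det (1 + R_s R_n⁻¹)` and Jensen's inequality -/

section rate

open scoped ComplexOrder in
/-- The determinant of `1 + W` with `W` positive semidefinite is a real number at least `1`. -/
theorem Matrix.PosSemidef.exists_det_one_add_eq {ι : Type*} [Fintype ι] [DecidableEq ι]
    {W : Matrix ι ι ℂ} (hW : W.PosSemidef) : ∃ r : ℝ, 1 ≤ r ∧ (1 + W).det = r := by
  obtain ⟨U, d, hU, hd, rfl⟩ := hW.exists_unitary_diagonal
  refine ⟨∏ i, (1 + d i), ?_, by rw [det_one_add_unitary_conj hU]; push_cast; rfl⟩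
  exact Finset.prod_induction _ (fun x : ℝ => 1 ≤ x)
    (fun _ _ h h' => one_le_mul_of_one_le_of_one_le h h') le_rfl fun i _ => by linarith [hd i]

open scoped ComplexOrder in
theorem posSemidef_ofReal_smul_mul_conjTranspose {m n : Type*} [Finite m] [Fintype n] {a : ℝ}
    (ha : 0 ≤ a) (B : Matrix m n ℂ) : ((a : ℂ) • (B * Bᴴ)).PosSemidef :=
  (posSemidef_self_mul_conjTranspose B).smul (by exact_mod_cast ha)

theorem relayFactor_pos {nr : ℕ} (hnr : 1 ≤ nr) {α ρ : ℝ} (hα : 0 < α) (hρ : 0 ≤ ρ) :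
    0 < relayFactor nr α ρ := by
  have : (0 : ℝ) < nr := by exact_mod_cast hnr
  unfold relayFactor; positivity

variable {ns nr nd : ℕ} {α ρ : ℝ}

theorem exists_det_noiseCov_eq (ha : 0 ≤ relayFactor nr α ρ) (B : Matrix (Fin nd) (Fin nr) ℂ) :
    ∃ r : ℝ, 1 ≤ r ∧ (noiseCov α ρ B).det = r :=
  (posSemidef_ofReal_smul_mul_conjTranspose ha B).exists_det_one_add_eq

theorem isUnit_det_noiseCov (ha : 0 ≤ relayFactor nr α ρ) (B : Matrix (Fin nd) (Fin nr) ℂ) :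
    IsUnit (noiseCov α ρ B).det := by
  obtain ⟨r, hr, h⟩ := exists_det_noiseCov_eq ha B
  rw [h]
  exact isUnit_iff_ne_zero.2 (by exact_mod_cast (by linarith : r ≠ 0))

theorem det_one_add_signalCov_mul_inv (ha : 0 ≤ relayFactor nr α ρ)
    (A : Matrix (Fin nr) (Fin ns) ℂ) (B : Matrix (Fin nd) (Fin nr) ℂ) :
    (1 + signalCov α ρ A B * (noiseCov α ρ B)⁻¹).det
      = (noiseCov α ρ B + signalCov α ρ A B).det / (noiseCov α ρ B).det := by
  have hu := isUnit_det_noiseCov ha B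
  refine eq_div_of_mul_eq hu.ne_zero ?_
  rw [← det_mul, Matrix.add_mul, Matrix.mul_assoc, nonsing_inv_mul _ hu, Matrix.one_mul,
    Matrix.mul_one]

open scoped ComplexOrder in
theorem exists_det_one_add_signalCov_eq (hρ : 0 ≤ ρ) (ha : 0 ≤ relayFactor nr α ρ)
    (A : Matrix (Fin nr) (Fin ns) ℂ) (B : Matrix (Fin nd) (Fin nr) ℂ) :
    ∃ r : ℝ, 1 ≤ r ∧ (1 + signalCov α ρ A B * (noiseCov α ρ B)⁻¹).det = r := by
  have hpd : (noiseCov α ρ B).PosDef :=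
    PosDef.one.add_posSemidef (posSemidef_ofReal_smul_mul_conjTranspose ha B)
  have hpsd := hpd.inv.posSemidef.conjTranspose_mul_mul_same (B * A)
  have hc : (0 : ℝ) ≤ ρ * relayFactor nr α ρ / ns := by positivity
  have h2 : (((ρ * relayFactor nr α ρ / ns : ℝ) : ℂ) •
      ((B * A)ᴴ * (noiseCov α ρ B)⁻¹ * (B * A))).PosSemidef :=
    hpsd.smul (by exact_mod_cast hc)
  obtain ⟨r, hr, h⟩ := h2.exists_det_one_add_eq
  refine ⟨r, hr, ?_⟩
  rw [← h, ← Matrix.mul_smul, det_one_add_mul_comm ((B * A)ᴴ * (noiseCov α ρ B)⁻¹)]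
  unfold signalCov
  rw [smul_mul, smul_mul, conjTranspose_mul]
  simp only [Matrix.mul_assoc]

/-- The value of `E det (1 + R_s R_n⁻¹)` in terms of the polynomial `wishartRatioPoly`; that it is
this mean is `integral_rateDet`. -/
noncomputable def meanRateDet (ns nr nd : ℕ) (α ρ : ℝ) : ℝ :=
  fallingPairing ℝ ns ((wishartRatioPoly (max nd nr) (min nd nr) (relayFactor nr α ρ)).comp
    (Polynomial.C (relayFactor nr α ρ) +
      Polynomial.C (ρ * relayFactor nr α ρ / ns) * Polynomial.X))

/-- The determinant `det (1 + R_s R_n⁻¹)` as a function of the entries of the two channels. -/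
noncomputable def rateDet (ns nr nd : ℕ) (α ρ : ℝ)
    (z : (Fin nr × Fin ns → ℂ) × (Fin nd × Fin nr → ℂ)) : ℂ :=
  (1 + signalCov α ρ (of fun i j => z.1 (i, j)) (of fun i j => z.2 (i, j)) *
    (noiseCov α ρ (of fun i j => z.2 (i, j)))⁻¹).det

theorem rateDet_eq_div (ha : 0 ≤ relayFactor nr α ρ)
    (z : (Fin nr × Fin ns → ℂ) × (Fin nd × Fin nr → ℂ)) :
    rateDet ns nr nd α ρ z = (noiseCov α ρ (of fun i j => z.2 (i, j)) +
        signalCov α ρ (of fun i j => z.1 (i, j)) (of fun i j => z.2 (i, j))).det /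
      (noiseCov α ρ (of fun i j => z.2 (i, j))).det :=
  det_one_add_signalCov_mul_inv ha _ _

theorem measurable_rateDet (ha : 0 ≤ relayFactor nr α ρ) :
    Measurable (rateDet ns nr nd α ρ) := by
  have h : rateDet ns nr nd α ρ = _ := funext fun z => rateDet_eq_div ha z
  rw [h]
  unfold noiseCov signalCov
  exact (Continuous.measurable (by fun_prop)).div (Continuous.measurable (by fun_prop))

theorem integrable_rateDet (ha : 0 ≤ relayFactor nr α ρ) :
    Integrable (rateDet ns nr nd α ρ)
      ((Measure.pi fun _ => stdComplexGaussian).prod (Measure.pi fun _ => stdComplexGaussian)) := by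
  have hA : MatrixHasAllMoments (fun z : (Fin nr × Fin ns → ℂ) × (Fin nd × Fin nr → ℂ) =>
      (of fun i j => z.1 (i, j) : Matrix (Fin nr) (Fin ns) ℂ))
      ((Measure.pi fun _ => stdComplexGaussian).prod (Measure.pi fun _ => stdComplexGaussian)) :=
    fun i j => (hasAllMoments_id_stdComplexGaussian.comp_measurePreserving
      (measurePreserving_eval (fun _ => stdComplexGaussian) (i, j))).comp_measurePreserving
        measurePreserving_fst
  have hB : MatrixHasAllMoments (fun z : (Fin nr × Fin ns → ℂ) × (Fin nd × Fin nr → ℂ) =>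
      (of fun i j => z.2 (i, j) : Matrix (Fin nd) (Fin nr) ℂ))
      ((Measure.pi fun _ => stdComplexGaussian).prod (Measure.pi fun _ => stdComplexGaussian)) :=
    fun i j => (hasAllMoments_id_stdComplexGaussian.comp_measurePreserving
      (measurePreserving_eval (fun _ => stdComplexGaussian) (i, j))).comp_measurePreserving
        measurePreserving_snd
  have hnum := (((MatrixHasAllMoments.const 1).add ((hB.mul hB.conjTranspose).smul
    (relayFactor nr α ρ : ℂ))).add ((((hB.mul hA).mul hA.conjTranspose).mul
      hB.conjTranspose).smul ((ρ * relayFactor nr α ρ / ns : ℝ) : ℂ))).det.integrable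
  refine hnum.mono (measurable_rateDet ha).aestronglyMeasurable
    (Filter.Eventually.of_forall fun z => ?_)
  rw [rateDet_eq_div ha, norm_div]
  obtain ⟨r, hr, h⟩ := exists_det_noiseCov_eq ha (of fun i j => z.2 (i, j))
  rw [h, Complex.norm_real, Real.norm_of_nonneg (by linarith)]
  exact div_le_self (norm_nonneg _) hr

theorem integral_rateDet (hnr : 1 ≤ nr) (hnd : 1 ≤ nd) (ha : 0 ≤ relayFactor nr α ρ) :
    ∫ z, rateDet ns nr nd α ρ z
      ∂((Measure.pi fun _ => stdComplexGaussian).prod (Measure.pi fun _ => stdComplexGaussian))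
      = (meanRateDet ns nr nd α ρ : ℂ) := by
  rw [integral_prod_symm _ (integrable_rateDet ha)]
  set a := relayFactor nr α ρ with ha_def
  set c := ρ * relayFactor nr α ρ / ns with hc_def
  have inner : ∀ y : Fin nd × Fin nr → ℂ,
      ∫ x, rateDet ns nr nd α ρ (x, y) ∂(Measure.pi fun _ => stdComplexGaussian)
      = fallingPairing ℂ ns (detPencil
          ((c : ℂ) • ((of fun i j => y (i, j) : Matrix (Fin nd) (Fin nr) ℂ) *
            (of fun i j => y (i, j))ᴴ))
          (1 + (a : ℂ) • ((of fun i j => y (i, j) : Matrix (Fin nd) (Fin nr) ℂ) *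
            (of fun i j => y (i, j))ᴴ))) /
        (1 + (a : ℂ) • ((of fun i j => y (i, j) : Matrix (Fin nd) (Fin nr) ℂ) *
            (of fun i j => y (i, j))ᴴ)).det := by
    intro y
    simp_rw [rateDet_eq_div ha]
    rw [integral_div, ← integral_det_firstHop]
    rfl
  simp_rw [inner]
  set g := wishartRatioPoly (max nd nr) (min nd nr) a with hg
  obtain ⟨k, hk⟩ := Polynomial.exists_linearMap_eq_sum_eval (fallingPairing ℂ ns)
    (Fintype.card (Fin nd) + 1)
  have hgdeg : ((g.comp (Polynomial.C a + Polynomial.C c * Polynomial.X)).map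
      Complex.ofRealHom).degree < (Fintype.card (Fin nd) + 1 : ℕ) := by
    refine lt_of_le_of_lt Polynomial.degree_le_natDegree ?_
    have h1 : (Polynomial.C a + Polynomial.C c * Polynomial.X : Polynomial ℝ).natDegree ≤ 1 := by
      compute_degree
    have h2 : g.natDegree ≤ min nd nr := wishartRatioPoly_natDegree_le (by omega) _ _
    have h3 := Polynomial.natDegree_comp_le (p := g)
      (q := Polynomial.C a + Polynomial.C c * Polynomial.X)
    have h4 := Polynomial.natDegree_map_le (f := Complex.ofRealHom)
      (p := g.comp (Polynomial.C a + Polynomial.C c * Polynomial.X))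
    have h5 : min nd nr ≤ nd := min_le_left _ _
    rw [Fintype.card_fin]
    have h6 : ((g.comp (Polynomial.C a + Polynomial.C c * Polynomial.X)).map
      Complex.ofRealHom).natDegree < nd + 1 := by nlinarith
    exact_mod_cast h6
  have hval : (meanRateDet ns nr nd α ρ : ℂ) = fallingPairing ℂ ns
      ((g.comp (Polynomial.C a + Polynomial.C c * Polynomial.X)).map Complex.ofRealHom) := by
    rw [fallingPairing_map]; rfl
  rw [hval, hk _ hgdeg]
  simp_rw [hk _ (detPencil_degree_lt _ _), detPencil_eval, Finset.sum_div, mul_div_assoc]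
  have hpencil : ∀ (t : ℂ) (S : Matrix (Fin nd) (Fin nd) ℂ),
      (t • (c : ℂ) • S + (1 + (a : ℂ) • S)).det = (1 + (a + c * t) • S).det := by
    intro t S
    congr 1
    rw [smul_smul, add_smul, mul_comm t]; abel
  simp_rw [hpencil]
  rw [integral_finsetSum]
  · refine Finset.sum_congr rfl fun i _ => ?_
    rw [integral_const_mul, integral_det_div_det_secondHop hnr hnd ha]
    congr 1
    simp [Polynomial.map_comp, Polynomial.eval_comp, hg]
  · intro i _
    refine Integrable.const_mul ?_ _
    have hB : MatrixHasAllMoments (fun y : Fin nd × Fin nr → ℂ =>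
        (of fun i j => y (i, j) : Matrix (Fin nd) (Fin nr) ℂ))
        (Measure.pi fun _ => stdComplexGaussian) :=
      fun i j => hasAllMoments_id_stdComplexGaussian.comp_measurePreserving
        (measurePreserving_eval (fun _ => stdComplexGaussian) (i, j))
    have hnum := ((MatrixHasAllMoments.const 1).add ((hB.mul hB.conjTranspose).smul
      ((a : ℂ) + c * ((i : ℕ) : ℂ)))).det.integrable
    refine hnum.mono ?_ (Filter.Eventually.of_forall fun z => ?_)
    · exact ((Continuous.measurable (by fun_prop)).div
        (Continuous.measurable (by fun_prop))).aestronglyMeasurable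
    · rw [norm_div]
      obtain ⟨r, hr, h⟩ := exists_det_noiseCov_eq ha (of fun i j => z (i, j))
      change _ / ‖(noiseCov α ρ (of fun i j => z (i, j))).det‖ ≤ _
      rw [h, Complex.norm_real, Real.norm_of_nonneg (by linarith)]
      exact div_le_self (norm_nonneg _) hr

/-- Jensen's inequality: the ergodic capacity is bounded by the logarithm of
`E det (1 + R_s R_n⁻¹)`. Integrability of the rate comes with the same tangent bound, because the
determinant is at least `1`. -/
theorem ergodicCapacity_le_logb_meanRateDet {Ω : Type*} [MeasurableSpace Ω] {μ : Measure Ω}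
    [IsProbabilityMeasure μ] (hnr : 1 ≤ nr) (hnd : 1 ≤ nd) (hρ : 0 ≤ ρ)
    (ha : 0 ≤ relayFactor nr α ρ)
    {H₁ : Ω → Matrix (Fin nr) (Fin ns) ℂ} {H₂ : Ω → Matrix (Fin nd) (Fin nr) ℂ}
    (hH : IsRayleighDualHop μ H₁ H₂) :
    Integrable (fun ω => logDetRate α ρ (H₁ ω) (H₂ ω)) μ ∧ 0 < meanRateDet ns nr nd α ρ ∧
      ergodicCapacity μ α ρ H₁ H₂ ≤ (1 / 2) * Real.logb 2 (meanRateDet ns nr nd α ρ) := by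
  have hlaw := hH.hasLaw
  set D : Ω → ℝ := fun ω => (1 + signalCov α ρ (H₁ ω) (H₂ ω) * (noiseCov α ρ (H₂ ω))⁻¹).det.re
    with hD
  have hcast : ∀ ω, (D ω : ℂ) = rateDet ns nr nd α ρ
      ((fun e => H₁ ω e.1 e.2), (fun e => H₂ ω e.1 e.2)) := by
    intro ω
    obtain ⟨r, _, h⟩ := exists_det_one_add_signalCov_eq hρ ha (H₁ ω) (H₂ ω)
    have : rateDet ns nr nd α ρ ((fun e => H₁ ω e.1 e.2), (fun e => H₂ ω e.1 e.2))
      = (1 + signalCov α ρ (H₁ ω) (H₂ ω) * (noiseCov α ρ (H₂ ω))⁻¹).det := rfl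
    rw [this, hD]
    simp [h]
  have hone : ∀ ω, 1 ≤ D ω := by
    intro ω
    obtain ⟨r, hr, h⟩ := exists_det_one_add_signalCov_eq hρ ha (H₁ ω) (H₂ ω)
    simpa [hD, h] using hr
  have hDint : Integrable (fun ω => (D ω : ℂ)) μ := by
    simp_rw [hcast]
    have := integrable_rateDet (ns := ns) (nd := nd) ha
    rw [← hlaw.map_eq] at this
    exact this.comp_aemeasurable hlaw.aemeasurable
  have hDr : Integrable D μ := by simpa using hDint.re
  have hmean : ∫ ω, D ω ∂μ = meanRateDet ns nr nd α ρ := by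
    have h1 : ∫ ω, (D ω : ℂ) ∂μ = (meanRateDet ns nr nd α ρ : ℂ) := by
      simp_rw [hcast]
      rw [← integral_rateDet hnr hnd ha, ← hlaw.map_eq, integral_map hlaw.aemeasurable
        (measurable_rateDet ha).aestronglyMeasurable]
    rw [integral_complex_ofReal] at h1
    exact_mod_cast h1
  have hm1 : 1 ≤ meanRateDet ns nr nd α ρ := by
    rw [← hmean]
    have := integral_mono (μ := μ) (integrable_const 1) hDr hone
    simpa using this
  set m := meanRateDet ns nr nd α ρ with hm
  have hm0 : 0 < m := by linarith
  have hlog2 : 0 < Real.log 2 := Real.log_pos (by norm_num)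
  -- the tangent of the logarithm at the mean
  have hle : ∀ ω, Real.logb 2 (D ω) ≤ Real.logb 2 m + (D ω / m - 1) / Real.log 2 := by
    intro ω
    have hpos : 0 < D ω := by linarith [hone ω]
    have h1 := Real.log_le_sub_one_of_pos (div_pos hpos hm0)
    rw [Real.log_div hpos.ne' hm0.ne'] at h1
    rw [Real.logb, Real.logb, ← add_div]
    exact div_le_div_of_nonneg_right (by linarith) hlog2.le
  have hbint : Integrable (fun ω => Real.logb 2 m + (D ω / m - 1) / Real.log 2) μ :=
    (integrable_const _).add (((hDr.div_const _).sub (integrable_const _)).div_const _)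
  have hlint : Integrable (fun ω => Real.logb 2 (D ω)) μ := by
    refine hbint.mono ?_ (Filter.Eventually.of_forall fun ω => ?_)
    · exact (Real.measurable_log.comp_aemeasurable hDr.aemeasurable).div_const _
        |>.aestronglyMeasurable
    · have h0 : 0 ≤ Real.logb 2 (D ω) := Real.logb_nonneg (by norm_num) (hone ω)
      rw [Real.norm_of_nonneg h0]
      exact (hle ω).trans (le_abs_self _)
  refine ⟨hlint, hm0, ?_⟩
  have hJ : ∫ ω, Real.logb 2 (D ω) ∂μ ≤ Real.logb 2 m := by
    refine (integral_mono hlint hbint hle).trans ?_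
    have hsub : Integrable (fun ω => (D ω / m - 1) / Real.log 2) μ :=
      ((hDr.div_const _).sub (integrable_const _)).div_const _
    rw [integral_add (integrable_const _) hsub, integral_div,
      integral_sub (hDr.div_const _) (integrable_const _), integral_div, hmean]
    simp [div_self hm0.ne']
  exact mul_le_mul_of_nonneg_left hJ (by norm_num)

end rate

/-! ### Functions of polynomial growth on the half-line -/

section polyGrowth
open Filter Asymptotics

/-- The function `f` is continuous on `[0, ∞)` and grows at most like a power of `x`. -/
structure PolyGrowth (f : ℝ → ℝ) : Prop where
  continuousOn : ContinuousOn f (Set.Ici 0)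
  isBigO : ∃ m : ℕ, f =O[atTop] fun x => x ^ m

namespace PolyGrowth

variable {f g : ℝ → ℝ}

theorem mul (hf : PolyGrowth f) (hg : PolyGrowth g) : PolyGrowth fun x => f x * g x := by
  obtain ⟨m, hm⟩ := hf.isBigO
  obtain ⟨n, hn⟩ := hg.isBigO
  exact ⟨hf.continuousOn.mul hg.continuousOn, m + n, by simpa [pow_add] using hm.mul hn⟩

theorem eval (P : Polynomial ℝ) : PolyGrowth fun x => P.eval x := by
  refine ⟨P.continuous.continuousOn, P.natDegree, ?_⟩
  have := Polynomial.isBigO_atTop_of_degree_le P (Polynomial.X ^ P.natDegree)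
    (by rw [Polynomial.degree_X_pow]; exact Polynomial.degree_le_natDegree)
  simpa using this

theorem inv_pow {a : ℝ} (ha : 0 ≤ a) (n : ℕ) : PolyGrowth fun x => ((1 + a * x)⁻¹) ^ n := by
  have h1 : ∀ x ∈ Set.Ici (0 : ℝ), 1 ≤ 1 + a * x := fun x hx => by
    have := mul_nonneg ha hx; linarith
  refine ⟨?_, 0, ?_⟩
  · refine ContinuousOn.pow (ContinuousOn.inv₀ (by fun_prop) fun x hx => ?_) n
    have := h1 x hx; positivity
  · refine IsBigO.of_bound 1 ?_
    filter_upwards [eventually_ge_atTop 0] with x hx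
    have := h1 x hx
    rw [Real.norm_of_nonneg (by positivity)]
    simpa using pow_le_one₀ (by positivity) (inv_le_one_of_one_le₀ this)

theorem isBigO_exp (hf : PolyGrowth f) :
    (fun x => Real.exp (-x) * f x) =O[atTop] fun x => Real.exp (-(1 / 2) * x) := by
  obtain ⟨m, hm⟩ := hf.isBigO
  have h1 := hm.trans (isLittleO_pow_exp_pos_mul_atTop m (b := 1 / 2) (by norm_num)).isBigO
  have h2 := (isBigO_refl (fun x : ℝ => Real.exp (-x)) atTop).mul h1
  refine h2.congr_right fun x => ?_
  rw [← Real.exp_add]; congr 1; ring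

theorem integrableOn (hf : PolyGrowth f) :
    IntegrableOn (fun x => Real.exp (-x) * f x) (Set.Ioi 0) :=
  integrable_of_isBigO_exp_neg (b := 1 / 2) (by norm_num)
    ((by fun_prop : Continuous fun x : ℝ => Real.exp (-x)).continuousOn.mul hf.continuousOn)
    hf.isBigO_exp

theorem tendsto_zero (hf : PolyGrowth f) :
    Tendsto (fun x => Real.exp (-x) * f x) atTop (nhds 0) := by
  refine hf.isBigO_exp.trans_tendsto ?_
  refine Real.tendsto_exp_atBot.comp ?_
  exact tendsto_id.const_mul_atTop_of_neg (by norm_num)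

end PolyGrowth

end polyGrowth

/-! ### Laguerre polynomials -/

section laguerre
open Polynomial

/-- The monic Laguerre polynomial of degree `n` and parameter `N - n`:
`∑ₖ (-1)ᵏ N (N - 1) ⋯ (N - k + 1) (n choose k) xⁿ⁻ᵏ`. -/
noncomputable def laguerre (N n : ℕ) (x : ℝ) : ℝ :=
  fallingPairing ℝ N ((C x - X) ^ n)

/-- The functional `fallingPairing` as a combination of evaluations at `0, 1, …`, with coefficients
that do not depend on the degree `n < M`. -/
theorem laguerre_eq_sum (N M : ℕ) :
    ∃ c : Fin M → ℝ, ∀ n < M, ∀ x, laguerre N n x = ∑ i, c i * (x - ((i : ℕ) : ℝ)) ^ n := by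
  obtain ⟨c, hc⟩ := exists_linearMap_eq_sum_eval (fallingPairing ℝ N) M
  refine ⟨c, fun n hn x => ?_⟩
  rw [laguerre, hc]
  · simp
  · have h1 : (C x - X : ℝ[X]).natDegree ≤ 1 := by compute_degree
    have h2 : ((C x - X : ℝ[X]) ^ n).natDegree ≤ n := by
      refine natDegree_pow_le.trans ?_; nlinarith
    exact lt_of_le_of_lt degree_le_natDegree (by exact_mod_cast lt_of_le_of_lt h2 hn)

theorem hasDerivAt_laguerre (N n : ℕ) (x : ℝ) :
    HasDerivAt (laguerre N n) (n * laguerre N (n - 1) x) x := by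
  obtain ⟨c, hc⟩ := laguerre_eq_sum N (n + 1)
  have h : laguerre N n = fun x => ∑ i, c i * (x - ((i : ℕ) : ℝ)) ^ n :=
    funext fun x => hc n (by omega) x
  rw [h, hc (n - 1) (by omega), Finset.mul_sum]
  refine HasDerivAt.fun_sum fun i _ => ?_
  have := (((hasDerivAt_id x).sub_const ((i : ℕ) : ℝ)).pow n).const_mul (c i)
  refine this.congr_deriv ?_
  simp; ring

theorem polyGrowth_laguerre (N n : ℕ) : PolyGrowth (laguerre N n) := by
  obtain ⟨c, hc⟩ := laguerre_eq_sum N (n + 1)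
  have h : laguerre N n
      = fun x => (∑ i, C (c i) * (X - C ((i : ℕ) : ℝ)) ^ n : ℝ[X]).eval x := by
    funext x
    rw [hc n (by omega), eval_finsetSum]
    simp
  rw [h]
  exact PolyGrowth.eval _

theorem laguerre_succ (N n : ℕ) (x : ℝ) :
    laguerre N (n + 1) x
      = (x - (N - n)) * laguerre N n x - n * x * laguerre N (n - 1) x := by
  have h1 : (C x - X : ℝ[X]) ^ (n + 1) = x • (C x - X) ^ n - X * (C x - X) ^ n := by
    rw [smul_eq_C_mul]; ring
  have h2 : X * derivative ((C x - X : ℝ[X]) ^ n)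
      = (n : ℝ) • (C x - X) ^ n - ((n : ℝ) * x) • (C x - X) ^ (n - 1) := by
    rw [derivative_pow]
    cases n with
    | zero => simp
    | succ n =>
      simp only [smul_eq_C_mul, Nat.add_sub_cancel, derivative_sub, derivative_C, derivative_X,
        C_mul]
      ring
  rw [laguerre, h1, map_sub, map_smul, fallingPairing_X_mul, h2, map_sub, map_smul, map_smul]
  simp only [smul_eq_mul, laguerre]
  ring

/-- The function `x ^ (N - n) e ^ (-x) Lₙ(x)`, which equals `(-1)ⁿ (d/dx)ⁿ (x ^ N e ^ (-x))`. -/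
noncomputable def laguerreWeighted (N n : ℕ) (x : ℝ) : ℝ :=
  Real.exp (-x) * (x ^ (N - n) * laguerre N n x)

theorem hasDerivAt_laguerreWeighted {N n : ℕ} (hn : n < N) (x : ℝ) :
    HasDerivAt (laguerreWeighted N n) (-laguerreWeighted N (n + 1) x) x := by
  have h1 : HasDerivAt (fun x : ℝ => Real.exp (-x)) (Real.exp (-x) * -1) x :=
    (hasDerivAt_neg x).exp
  have h2 := h1.mul ((hasDerivAt_pow (N - n) x).mul (hasDerivAt_laguerre N n x))
  refine h2.congr_deriv ?_
  obtain ⟨d, rfl⟩ : ∃ d, N = n + 1 + d := ⟨N - (n + 1), by omega⟩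
  have e1 : n + 1 + d - n = d + 1 := by omega
  have e2 : n + 1 + d - (n + 1) = d := by omega
  rw [laguerreWeighted, laguerre_succ, e1, e2]
  simp only [Nat.add_sub_cancel, Pi.mul_apply]
  push_cast
  ring

theorem polyGrowth_laguerreWeighted_mul (N n : ℕ) {f : ℝ → ℝ} (hf : PolyGrowth f) :
    PolyGrowth fun x => x ^ (N - n) * laguerre N n x * f x := by
  have h := ((PolyGrowth.eval (X ^ (N - n))).mul (polyGrowth_laguerre N n)).mul hf
  simpa using h

theorem laguerreWeighted_mul_eq (N n : ℕ) (f : ℝ → ℝ) (x : ℝ) :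
    laguerreWeighted N n x * f x = Real.exp (-x) * (x ^ (N - n) * laguerre N n x * f x) := by
  rw [laguerreWeighted]; ring

theorem integrableOn_laguerreWeighted_mul (N n : ℕ) {f : ℝ → ℝ} (hf : PolyGrowth f) :
    IntegrableOn (fun x => laguerreWeighted N n x * f x) (Set.Ioi 0) := by
  simp_rw [laguerreWeighted_mul_eq]
  exact (polyGrowth_laguerreWeighted_mul N n hf).integrableOn

/-- One integration by parts against a Rodrigues-type weight. -/
theorem integral_laguerreWeighted_succ_mul {N n : ℕ} (hn : n < N) {f f' : ℝ → ℝ}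
    (hf : PolyGrowth f) (hf' : PolyGrowth f')
    (hd : ∀ x ∈ Set.Ioi (0 : ℝ), HasDerivAt f (f' x) x) :
    ∫ x in Set.Ioi (0 : ℝ), laguerreWeighted N (n + 1) x * f x
      = ∫ x in Set.Ioi (0 : ℝ), laguerreWeighted N n x * f' x := by
  have hi1 := integrableOn_laguerreWeighted_mul N (n + 1) hf
  have hi2 := integrableOn_laguerreWeighted_mul N n hf'
  have hderiv : ∀ x ∈ Set.Ioi (0 : ℝ), HasDerivAt (fun x => laguerreWeighted N n x * f x)
      (laguerreWeighted N n x * f' x - laguerreWeighted N (n + 1) x * f x) x := by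
    intro x hx
    refine ((hasDerivAt_laguerreWeighted hn x).mul (hd x hx)).congr_deriv ?_
    ring
  have hcont : ContinuousWithinAt (fun x => laguerreWeighted N n x * f x) (Set.Ici 0) 0 := by
    refine ContinuousWithinAt.mul ?_ (hf.continuousOn 0 (by simp))
    exact (hasDerivAt_laguerreWeighted hn 0).continuousAt.continuousWithinAt
  have hlim : Filter.Tendsto (fun x => laguerreWeighted N n x * f x) Filter.atTop (nhds 0) := by
    simp_rw [laguerreWeighted_mul_eq]
    exact (polyGrowth_laguerreWeighted_mul N n hf).tendsto_zero
  have key := integral_Ioi_of_hasDerivAt_of_tendsto hcont hderiv (hi2.sub hi1) hlim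
  have h0 : laguerreWeighted N n 0 = 0 := by
    rw [laguerreWeighted, zero_pow (by omega)]; simp
  rw [integral_sub hi2 hi1, h0] at key
  linarith

/-- Repeated integration by parts; `F k` is the `k`-th derivative of `F 0`. -/
theorem integral_laguerreWeighted_mul {N : ℕ} (F : ℕ → ℝ → ℝ) (hF : ∀ k, PolyGrowth (F k))
    (hd : ∀ k, ∀ x ∈ Set.Ioi (0 : ℝ), HasDerivAt (F k) (F (k + 1) x) x) (n k : ℕ) (hn : n ≤ N) :
    ∫ x in Set.Ioi (0 : ℝ), laguerreWeighted N n x * F k x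
      = ∫ x in Set.Ioi (0 : ℝ), laguerreWeighted N 0 x * F (k + n) x := by
  induction n generalizing k with
  | zero => rfl
  | succ n ih =>
    rw [integral_laguerreWeighted_succ_mul (by omega) (hF k) (hF (k + 1)) (hd k),
      ih (k + 1) (by omega)]
    congr 3 with x
    congr 2; omega

theorem laguerreWeighted_zero (N : ℕ) (x : ℝ) :
    laguerreWeighted N 0 x = x ^ N * Real.exp (-x) := by
  rw [laguerreWeighted, laguerre, pow_zero, ← C_1, fallingPairing_C]
  simp [mul_comm]

/-- Orthogonality of the Laguerre polynomials. -/
theorem integral_laguerreWeighted_mul_eval {N n : ℕ} (hn : n ≤ N) (P : ℝ[X])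
    (hP : P.degree < n) :
    ∫ x in Set.Ioi (0 : ℝ), laguerreWeighted N n x * P.eval x = 0 := by
  have := integral_laguerreWeighted_mul (N := N) (fun k x => (derivative^[k] P).eval x)
    (fun k => PolyGrowth.eval _) (fun k x _ => by
      rw [Function.iterate_succ_apply']; exact Polynomial.hasDerivAt _ _) n 0 hn
  simp only [Function.iterate_zero, id_eq, zero_add] at this
  rw [this, iterate_derivative_eq_zero_of_degree_lt hP]
  simp

/-- The Stieltjes-type transform of a Laguerre polynomial. -/
theorem integral_laguerreWeighted_mul_inv {N n : ℕ} (hn : n ≤ N) {a : ℝ} (ha : 0 ≤ a) :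
    ∫ x in Set.Ioi (0 : ℝ), laguerreWeighted N n x * (1 + a * x)⁻¹
      = (-a) ^ n * n.factorial *
        ∫ x in Set.Ioi (0 : ℝ), x ^ N * Real.exp (-x) * ((1 + a * x)⁻¹) ^ (n + 1) := by
  have := integral_laguerreWeighted_mul (N := N)
    (fun k x => ((-a) ^ k * k.factorial) * ((1 + a * x)⁻¹) ^ (k + 1))
    (fun k => by
      have := (PolyGrowth.eval (C ((-a) ^ k * k.factorial))).mul (PolyGrowth.inv_pow ha (k + 1))
      simpa using this)
    (fun k x hx => by
      have hpos : 1 + a * x ≠ 0 := by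
        have := mul_nonneg ha (le_of_lt hx); positivity
      have h1 : HasDerivAt (fun x => 1 + a * x) a x := by
        simpa using ((hasDerivAt_id x).const_mul a).const_add 1
      have h2 := ((h1.inv hpos).pow (k + 1)).const_mul ((-a) ^ k * k.factorial)
      refine h2.congr_deriv ?_
      simp only [Nat.add_sub_cancel, Pi.inv_apply, Nat.factorial_succ]
      push_cast
      rw [div_eq_mul_inv, ← inv_pow]
      ring) n 0 hn
  simp only [pow_zero, Nat.factorial_zero, Nat.cast_one, one_mul, zero_add, pow_one] at this
  rw [this, ← integral_const_mul]
  refine integral_congr_ae (Filter.Eventually.of_forall fun x => ?_)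
  simp only [laguerreWeighted_zero]
  ring

end laguerre

/-! ### Orthogonality of the reversed mean ratio -/

section orthogonality
open Polynomial

/-- Up to the power of `x`, the reversed polynomial of `wishartRatioPoly` is a combination of two
Laguerre polynomials. -/
theorem pow_mul_wishartRatioPoly_eval (r s : ℕ) (a : ℝ) {x : ℝ} (hx : x ≠ 0) :
    x ^ (s + 1) * (wishartRatioPoly (r + 1) (s + 1) a).eval (-x⁻¹)
      = gaussNegMoment (Fin (s + 1)) a (r + 1) * (x * laguerre (r + 1) s x)
        - (r + 1) * gaussNegMoment (Fin (s + 1)) a (r + 2) * laguerre r s x := by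
  rw [wishartRatioPoly, fallingTransform_eval, ← smul_eq_mul, ← map_smul, laguerre, laguerre]
  have hC : (C x * C (x⁻¹) : ℝ[X]) = 1 := by rw [← C_mul, mul_inv_cancel₀ hx, C_1]
  set u := gaussNegMoment (Fin (s + 1)) a (r + 1)
  set v := gaussNegMoment (Fin (s + 1)) a (r + 1 + 1)
  have h : x ^ (s + 1) • (((1 + X) ^ (s + 1 - 1) * (C u + C v * X) : ℝ[X]).comp (C (-x⁻¹) * X))
      = (u * x) • (C x - X) ^ s - v • (X * (C x - X) ^ s) := by
    simp only [smul_eq_C_mul, mul_comp, pow_comp, add_comp, one_comp, X_comp, C_comp, C_neg,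
      Nat.add_sub_cancel, C_mul, C_pow]
    have h1 : (C x - X : ℝ[X]) = C x * (1 + -C (x⁻¹) * X) := by
      linear_combination X * hC
    rw [h1, mul_pow]
    linear_combination -C v * C x ^ s * (1 + -C (x⁻¹) * X) ^ s * X * hC
  rw [h, map_sub, map_smul, map_smul, fallingPairing_succ_X_mul]
  simp only [smul_eq_mul]
  ring

/-- The reversed polynomial of `wishartRatioPoly` is orthogonal to the polynomials of smaller
degree for the weight `x ^ (p - q) e ^ (-x) / (1 + a x)`, where `p = r + 1` and `q = s + 1`. -/
theorem integral_eval_mul_wishartRatioPoly_eval {r s : ℕ} (hsr : s ≤ r) {a : ℝ} (ha : 0 < a)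
    (P : ℝ[X]) (hP : P.degree < (s + 1 : ℕ)) :
    ∫ x in Set.Ioi (0 : ℝ), x ^ (r - s) * Real.exp (-x) * (1 + a * x)⁻¹ * P.eval x *
      (x ^ (s + 1) * (wishartRatioPoly (r + 1) (s + 1) a).eval (-x⁻¹)) = 0 := by
  set u := gaussNegMoment (Fin (s + 1)) a (r + 1) with hu
  set v := gaussNegMoment (Fin (s + 1)) a (r + 2) with hv
  set R := P /ₘ (X - C (-a⁻¹)) with hR
  set t := P.eval (-a⁻¹) with ht
  -- divide `P` by `x + 1/a`: the quotient is orthogonal to both Laguerre polynomials, and the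
  -- remainder only meets their Stieltjes transforms, which cancel
  have hdecomp : ∀ x, P.eval x = t + (x + a⁻¹) * R.eval x := by
    intro x
    have := congrArg (eval x) (modByMonic_add_div P (X - C (-a⁻¹)))
    rw [modByMonic_X_sub_C_eq_C_eval] at this
    rw [← this]
    simp [hR, ht, sub_neg_eq_add]
  have hRdeg : R.degree < s := by
    by_cases h0 : P = 0
    · simp [hR, h0]
    · have h1 := degree_divByMonic_lt P (X - C (-a⁻¹)) h0
        (by rw [degree_X_sub_C]; norm_num)
      have h2 : R.degree < P.degree := h1
      by_cases hR0 : R = 0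
      · rw [hR0]; simp
      · rw [degree_eq_natDegree hR0] at h2 ⊢
        rw [degree_eq_natDegree h0] at h2 hP
        norm_cast at *
        omega
  have hpoly : ∀ N, IntegrableOn (fun x => laguerreWeighted N s x * R.eval x) (Set.Ioi 0) :=
    fun N => integrableOn_laguerreWeighted_mul N s (PolyGrowth.eval R)
  have hinv : ∀ N, IntegrableOn (fun x => laguerreWeighted N s x * (1 + a * x)⁻¹) (Set.Ioi 0) :=
    fun N => integrableOn_laguerreWeighted_mul N s (by simpa using PolyGrowth.inv_pow ha.le 1)
  have hsplit : ∀ x ∈ Set.Ioi (0 : ℝ), x ^ (r - s) * Real.exp (-x) * (1 + a * x)⁻¹ * P.eval x *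
      (x ^ (s + 1) * (wishartRatioPoly (r + 1) (s + 1) a).eval (-x⁻¹))
      = ((u * a⁻¹) * (laguerreWeighted (r + 1) s x * R.eval x)
          - ((r + 1) * v * a⁻¹) * (laguerreWeighted r s x * R.eval x))
        + ((u * t) * (laguerreWeighted (r + 1) s x * (1 + a * x)⁻¹)
          - ((r + 1) * v * t) * (laguerreWeighted r s x * (1 + a * x)⁻¹)) := by
    intro x hx
    have hx : 0 < x := hx
    have h1 : 1 + a * x ≠ 0 := by positivity
    rw [pow_mul_wishartRatioPoly_eval r s a hx.ne', hdecomp, laguerreWeighted, laguerreWeighted,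
      show r + 1 - s = r - s + 1 by omega, pow_succ]
    rw [← hu, ← hv]
    field_simp
    ring
  rw [setIntegral_congr_fun measurableSet_Ioi hsplit, integral_add, integral_sub, integral_sub,
    integral_const_mul, integral_const_mul, integral_const_mul, integral_const_mul,
    integral_laguerreWeighted_mul_eval (by omega) R hRdeg,
    integral_laguerreWeighted_mul_eval hsr R hRdeg,
    integral_laguerreWeighted_mul_inv (by omega) ha.le,
    integral_laguerreWeighted_mul_inv hsr ha.le]
  · have e1 := factorial_mul_gaussNegMoment (ι := Fin (s + 1)) ha.le r
    have e2 := factorial_mul_gaussNegMoment (ι := Fin (s + 1)) ha.le (r + 1)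
    rw [Fintype.card_fin] at e1 e2
    rw [← e1, ← e2, ← hu, ← hv, Nat.factorial_succ]
    push_cast
    ring
  · exact (hinv _).const_mul _
  · exact (hinv _).const_mul _
  · exact (hpoly _).const_mul _
  · exact (hpoly _).const_mul _
  · exact ((hpoly _).const_mul _).sub ((hpoly _).const_mul _)
  · exact ((hinv _).const_mul _).sub ((hinv _).const_mul _)

/-- The coefficients of `E det (1 + (a + t) W) / det (1 + a W)` as a polynomial in `t`. -/
noncomputable def wishartRatioCoeff (p q : ℕ) (a : ℝ) (k : ℕ) : ℝ :=
  ((wishartRatioPoly p q a).comp (C a + X)).coeff k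

theorem wishartRatioPoly_comp_natDegree_le {q : ℕ} (hq : 1 ≤ q) (p : ℕ) (a : ℝ) :
    ((wishartRatioPoly p q a).comp (C a + X)).natDegree ≤ q := by
  have h : (C a + X : ℝ[X]).natDegree ≤ 1 := by compute_degree
  have h2 := wishartRatioPoly_natDegree_le hq p a
  refine natDegree_comp_le.trans ?_
  nlinarith

open scoped ComplexOrder in
theorem wishartRatioCoeff_zero {q : ℕ} (hq : 1 ≤ q) (p : ℕ) {a : ℝ} (ha : 0 ≤ a) :
    wishartRatioCoeff p q a 0 = 1 := by
  have h := integral_det_div_det_eq_eval hq ha (a : ℂ) p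
  -- at `β = a` the ratio of the two determinants is identically `1`
  have h1 : ∀ h : Fin p → Fin q → ℂ, (1 + (a : ℂ) • ∑ j, vecMulVec (h j) (star (h j))).det /
      (1 + (a : ℂ) • ∑ j, vecMulVec (h j) (star (h j))).det = 1 := by
    intro h
    obtain ⟨r, hr, he⟩ := (((posSemidef_sum_vecMulVec h)).smul
      (show (0 : ℂ) ≤ (a : ℂ) by exact_mod_cast ha)).exists_det_one_add_eq
    rw [he]
    exact div_self (by exact_mod_cast (by linarith : r ≠ 0))
  simp only [h1] at h
  rw [integral_const, probReal_univ, one_smul] at h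
  have h2 := Polynomial.eval_map_apply Complex.ofRealHom (p := wishartRatioPoly p q a) a
  rw [Complex.ofRealHom_eq_coe] at h2
  rw [h2] at h
  rw [wishartRatioCoeff, coeff_zero_eq_eval_zero, eval_comp]
  simp only [eval_add, eval_C, eval_X, add_zero]
  exact_mod_cast (show ((eval a (wishartRatioPoly p q a) : ℝ) : ℂ) = 1 from h.symm)

theorem homogeneous_natDegree_lt (a : ℝ) {s m : ℕ} (hm : m ≤ s) :
    (X ^ m * (1 + C a * X) ^ (s - m) : ℝ[X]).natDegree < s + 1 := by
  have h1 : (1 + C a * X : ℝ[X]).natDegree ≤ 1 := by compute_degree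
  have h2 : ((1 + C a * X : ℝ[X]) ^ (s - m)).natDegree ≤ s - m :=
    natDegree_pow_le.trans (by nlinarith)
  have h3 : (X ^ m : ℝ[X]).natDegree ≤ m := natDegree_X_pow_le m
  have h4 := natDegree_mul_le (p := (X ^ m : ℝ[X])) (q := (1 + C a * X : ℝ[X]) ^ (s - m))
  omega

/-- The moments of the weight `x ^ d e ^ (-x) / (1 + a x)` against the products of
`xᵐ (1 + a x) ^ (s - m)` and `xⁿ (1 + a x) ^ (s + 1 - n)`. The natural subtractions are exact for
`m ≤ s` and `n ≤ s + 1`, the only indices that are used. -/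
noncomputable def homogeneousMoment (d s : ℕ) (a : ℝ) (m n : ℕ) : ℝ :=
  ∫ x in Set.Ioi (0 : ℝ), x ^ (d + m + n) * Real.exp (-x) *
    (1 + a * x) ^ ((s - m) + (s + 1 - n)) * (1 + a * x)⁻¹

/-- The orthogonality relation as a linear relation between the columns of moments. -/
theorem sum_wishartRatioCoeff_mul_homogeneousMoment {r s : ℕ} (hsr : s ≤ r) {a : ℝ} (ha : 0 < a)
    {m : ℕ} (hm : m ≤ s) :
    ∑ k ∈ Finset.range (s + 2), (-1) ^ k * wishartRatioCoeff (r + 1) (s + 1) a k *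
      homogeneousMoment (r - s) s a m (s + 1 - k) = 0 := by
  have hint : ∀ k, IntegrableOn (fun x : ℝ => x ^ ((r - s) + m + k) * Real.exp (-x) *
      (1 + a * x) ^ ((s - m) + (s + 1 - k)) * (1 + a * x)⁻¹) (Set.Ioi 0) := by
    intro k
    have h := ((PolyGrowth.eval (X ^ ((r - s) + m + k) *
      (1 + C a * X) ^ ((s - m) + (s + 1 - k)))).mul (PolyGrowth.inv_pow ha.le 1)).integrableOn
    refine h.congr_fun (fun x _ => ?_) measurableSet_Ioi
    simp only [eval_mul, eval_pow, eval_X, eval_add, eval_one, eval_C]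
    ring
  have h0 := integral_eval_mul_wishartRatioPoly_eval hsr ha (X ^ m * (1 + C a * X) ^ (s - m))
    (lt_of_le_of_lt degree_le_natDegree (by exact_mod_cast homogeneous_natDegree_lt a hm))
  simp only [homogeneousMoment]
  simp_rw [← integral_const_mul]
  rw [← integral_finsetSum _ fun k _ => (hint _).const_mul _]
  refine Eq.trans (setIntegral_congr_fun measurableSet_Ioi fun x hx => ?_) h0
  have hx : 0 < x := hx
  have hx1 : 1 + a * x ≠ 0 := by positivity
  -- expand the polynomial around `a`
  have hexp : (wishartRatioPoly (r + 1) (s + 1) a).eval (-x⁻¹)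
      = ∑ k ∈ Finset.range (s + 2), wishartRatioCoeff (r + 1) (s + 1) a k *
        (-(1 + a * x) * x⁻¹) ^ k := by
    have h1 : ((wishartRatioPoly (r + 1) (s + 1) a).comp (C a + X)).eval (-(1 + a * x) * x⁻¹)
        = (wishartRatioPoly (r + 1) (s + 1) a).eval (-x⁻¹) := by
      rw [eval_comp]
      congr 1
      simp only [eval_add, eval_C, eval_X]
      field_simp
      ring
    rw [← h1, eval_eq_sum_range' (n := s + 2)]
    · rfl
    · have := wishartRatioPoly_comp_natDegree_le (q := s + 1) (by omega) (r + 1) a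
      omega
  simp only [hexp, Finset.mul_sum]
  refine Finset.sum_congr rfl fun k hk => ?_
  have hk' : k ≤ s + 1 := by simp at hk; omega
  obtain ⟨l, hl⟩ : ∃ l, s + 1 = k + l := ⟨s + 1 - k, by omega⟩
  have e1 : s + 1 - k = l := by omega
  have e2 : s + 1 - l = k := by omega
  rw [e1, e2, hl]
  simp only [eval_mul, eval_pow, eval_X, eval_add, eval_one, eval_C]
  rw [neg_mul, neg_pow ((1 + a * x) * x⁻¹), mul_pow, inv_pow]
  field_simp
  ring

end orthogonality

/-! ### Determinants with linearly related columns -/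

section columnRecurrence

/-- If the columns `f 0, …, f (s + 1)` of length `s + 1` satisfy a linear relation with leading
coefficient `1`, the determinant with columns `f j + c j • f (j + 1)` is a multiple of the one
with columns `f j`. -/
theorem det_add_mul_succ_of_sum_eq_zero {R : Type*} [CommRing R] {s : ℕ}
    (f : ℕ → Fin (s + 1) → R) (e c : ℕ → R) (he : e 0 = 1)
    (hrel : ∀ i, ∑ k ∈ Finset.range (s + 2), (-1) ^ k * e k * f (s + 1 - k) i = 0) :
    (of fun i j : Fin (s + 1) => f j i + c j * f (j + 1) i).det
      = (of fun i j : Fin (s + 1) => f j i).det *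
        ∑ k ∈ Finset.range (s + 2), e k * ∏ i ∈ Finset.range k, c (s - i) := by
  -- the relation expresses the last column through the others
  set γ : Fin (s + 1) → R := fun j => -((-1) ^ (s + 1 - (j : ℕ)) * e (s + 1 - (j : ℕ))) with hγ
  have hlast : ∀ i, f (s + 1) i = ∑ l : Fin (s + 1), f l i * γ l := by
    intro i
    have h := hrel i
    rw [Finset.sum_range_succ', he] at h
    rw [Fin.sum_univ_eq_sum_range
      (fun l => f l i * -((-1) ^ (s + 1 - l) * e (s + 1 - l))) (s + 1),
      ← Finset.sum_range_reflect]
    rw [pow_zero, Nat.sub_zero, one_mul, one_mul] at h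
    rw [eq_neg_of_add_eq_zero_right h, ← Finset.sum_neg_distrib]
    refine Finset.sum_congr rfl fun k hk => ?_
    have hk : k < s + 1 := Finset.mem_range.1 hk
    rw [show s + 1 - 1 - k = s + 1 - (k + 1) by omega,
      show s + 1 - (s + 1 - (k + 1)) = k + 1 by omega]
    ring
  -- the unipotent bidiagonal matrix, and the row that it maps to the last unit row
  set B : Matrix (Fin (s + 1)) (Fin (s + 1)) R := of fun l j =>
    (if l = j then 1 else 0) + (if (l : ℕ) = j + 1 then c j else 0) with hB
  set x : Fin (s + 1) → R := fun j => ∏ l ∈ Finset.Ico (j : ℕ) s, -c l with hx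
  set u : Fin (s + 1) → R := fun l => c s * γ l with hu
  have hxB : ∀ j, (x ᵥ* B) j = if (j : ℕ) = s then 1 else 0 := by
    intro j
    have h1 : (x ᵥ* B) j = x j + ∑ l : Fin (s + 1), (if (l : ℕ) = j + 1 then x l * c j else 0) := by
      simp only [vecMul, dotProduct, hB, of_apply, mul_add, Finset.sum_add_distrib, mul_ite,
        mul_one, mul_zero, Finset.sum_ite_eq', Finset.mem_univ, if_true]
    rw [h1]
    split_ifs with hj
    · rw [Finset.sum_eq_zero fun l _ => if_neg (by have := l.2; omega)]
      simp [hx, hj]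
    · have hj' : (j : ℕ) < s := by have := j.2; omega
      rw [Finset.sum_eq_single (⟨j + 1, by omega⟩ : Fin (s + 1)) (fun l _ hl => if_neg
        fun h => hl (Fin.ext h)) (by simp), if_pos rfl]
      simp only [hx]
      rw [Finset.prod_eq_prod_Ico_succ_bot hj']
      ring
  have hdetB : B.det = 1 := by
    rw [det_of_isLowerTriangular]
    · simp [hB]
    · intro i j hij
      have hij : (i : ℕ) < j := hij
      simp only [hB, of_apply]
      rw [if_neg (by rintro rfl; omega), if_neg (by omega), add_zero]
  have hfac : (of fun i j : Fin (s + 1) => f j i + c j * f (j + 1) i)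
      = (of fun i j : Fin (s + 1) => f j i) * ((1 + replicateCol Unit u * replicateRow Unit x) * B)
      := by
    set N : Matrix (Fin (s + 1)) (Fin (s + 1)) R :=
      (1 + replicateCol Unit u * replicateRow Unit x) * B with hNdef
    have hN : ∀ l j, N l j
        = B l j + u l * (if (j : ℕ) = s then 1 else 0) := by
      intro l j
      rw [← hxB j, hNdef, add_mul, one_mul, Matrix.mul_assoc, Matrix.add_apply, Matrix.mul_apply]
      simp [Matrix.mul_apply, vecMul, dotProduct]
    ext i j
    rw [Matrix.mul_apply]
    simp only [hN, of_apply, hB, mul_add, Finset.sum_add_distrib]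
    have e1 : ∑ l : Fin (s + 1), f l i * (if l = j then 1 else 0) = f j i := by simp
    rw [e1, add_assoc]
    congr 1
    by_cases hj : (j : ℕ) = s
    · rw [Finset.sum_eq_zero fun l _ => by rw [if_neg (by have := l.2; omega), mul_zero], zero_add]
      simp only [hj, if_true, mul_one, hu]
      rw [hlast, Finset.mul_sum]
      exact Finset.sum_congr rfl fun l _ => by ring
    · simp only [hj, if_false, mul_zero, Finset.sum_const_zero, add_zero]
      have hj' : (j : ℕ) < s := by have := j.2; omega
      rw [Finset.sum_eq_single (⟨j + 1, by omega⟩ : Fin (s + 1)) (fun l _ hl => by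
        rw [if_neg fun h => hl (Fin.ext h), mul_zero]) (by simp), if_pos rfl, mul_comm]
  rw [hfac, det_mul, det_mul, hdetB, mul_one, det_one_add_replicateCol_mul_replicateRow]
  congr 1
  rw [Finset.sum_range_succ', he, Finset.prod_range_zero, mul_one, add_comm]
  congr 1
  simp only [dotProduct, hx, hu, hγ]
  rw [Fin.sum_univ_eq_sum_range (fun l => (∏ m ∈ Finset.Ico l s, -c m) *
    (c s * -((-1) ^ (s + 1 - l) * e (s + 1 - l)))) (s + 1), ← Finset.sum_range_reflect]
  refine Finset.sum_congr rfl fun k hk => ?_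
  have hk : k < s + 1 := Finset.mem_range.1 hk
  rw [show s + 1 - 1 - k = s - k by omega, show s + 1 - (s - k) = k + 1 by omega,
    Finset.prod_range_succ', Finset.prod_Ico_eq_prod_range, ← Finset.prod_range_reflect,
    show s - (s - k) = k by omega, Finset.prod_neg, Finset.card_range, Nat.sub_zero]
  have h2 : ∏ i ∈ Finset.range k, c (s - k + (k - 1 - i)) = ∏ i ∈ Finset.range k, c (s - (i + 1)) :=
    Finset.prod_congr rfl fun i hi => by
      have := Finset.mem_range.1 hi
      congr 1; omega
  rw [h2]
  have h3 : ((-1 : R) ^ k) * (-1) ^ k = 1 := by rw [← mul_pow]; simp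
  rw [pow_succ]
  linear_combination (∏ i ∈ Finset.range k, c (s - (i + 1))) * c s * e (k + 1) * h3

end columnRecurrence

/-! ### The Gram determinant of the homogeneous basis -/

section hankel
open Polynomial

/-- A Hankel determinant of factorials: after the factor `(d + i)!` is taken out of row `i`, the
entries are monic polynomials in `i`, which gives a Vandermonde determinant. -/
theorem det_factorial_add (d s : ℕ) :
    (of fun i j : Fin (s + 1) => ((d + i + j).factorial : ℝ)).det
      = ∏ k ∈ Finset.range (s + 1), ((k.factorial : ℝ) * (d + k).factorial) := by
  have h1 : (of fun i j : Fin (s + 1) => ((d + i + j).factorial : ℝ))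
      = of fun i j : Fin (s + 1) => ((d + i).factorial : ℝ) *
        (of fun i j : Fin (s + 1) => (ascPochhammer ℝ j).eval (((i : ℕ) : ℝ) + (d + 1))) i j := by
    ext i j
    simp only [of_apply]
    rw [show (((i : ℕ) : ℝ) + (d + 1)) = ((d + i + 1 : ℕ) : ℝ) by push_cast; ring,
      ← ascPochhammer_eval_cast, ascPochhammer_nat_eq_ascFactorial]
    exact_mod_cast (Nat.factorial_mul_ascFactorial (d + i) j).symm
  rw [h1, det_mul_column, ← det_eval_matrixOfPolynomials_eq_det_vandermonde _
    (fun j : Fin (s + 1) => ascPochhammer ℝ j) (fun j => ascPochhammer_natDegree _ _)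
    (fun j => monic_ascPochhammer _ _), det_vandermonde_add,
    det_vandermonde_id_eq_superFactorial, ← Nat.prod_range_succ_factorial,
    Fin.prod_univ_eq_prod_range (fun i => ((d + i).factorial : ℝ)), Finset.prod_mul_distrib]
  push_cast
  ring

theorem homogeneousMoment_eq_integral_eval (d : ℕ) {s : ℕ} {a : ℝ} (ha : 0 ≤ a) {m n : ℕ}
    (hn : n ≤ s) :
    homogeneousMoment d s a m n = ∫ x in Set.Ioi (0 : ℝ), x ^ d * Real.exp (-x) *
      ((X ^ m * (1 + C a * X) ^ (s - m)).eval x * (X ^ n * (1 + C a * X) ^ (s - n)).eval x) := by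
  refine setIntegral_congr_fun measurableSet_Ioi fun x hx => ?_
  have hx : 0 < x := hx
  have h1 : 1 + a * x ≠ 0 := by positivity
  simp only [eval_mul, eval_pow, eval_X, eval_add, eval_one, eval_C]
  rw [show s - m + (s + 1 - n) = (s - m) + (s - n) + 1 by omega, pow_succ, pow_add, pow_add,
    pow_add]
  field_simp

/-- The homogeneous basis is unitriangular over the monomials, so its Gram determinant is the
Hankel determinant of the moments of `x ^ d e ^ (-x)`. -/
theorem det_homogeneousMoment (d s : ℕ) {a : ℝ} (ha : 0 ≤ a) :
    (of fun i j : Fin (s + 1) => homogeneousMoment d s a i j).det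
      = ∏ k ∈ Finset.range (s + 1), ((k.factorial : ℝ) * (d + k).factorial) := by
  set u : Fin (s + 1) → ℝ[X] := fun i => X ^ (i : ℕ) * (1 + C a * X) ^ (s - i) with hu
  set L : Matrix (Fin (s + 1)) (Fin (s + 1)) ℝ := of fun i l => (u i).coeff l with hL
  have hdetL : L.det = 1 := by
    rw [det_of_isUpperTriangular]
    · refine Finset.prod_eq_one fun i _ => ?_
      simp [hL, hu, coeff_X_pow_mul', coeff_zero_eq_eval_zero]
    · intro i j hij
      have hij : (j : ℕ) < i := hij
      simp only [hL, hu, of_apply, coeff_X_pow_mul']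
      rw [if_neg (by omega)]
  have hev : ∀ i x, (u i).eval x = ∑ l : Fin (s + 1), L i l * x ^ (l : ℕ) := by
    intro i x
    rw [eval_eq_sum_range' (homogeneous_natDegree_lt a (Nat.lt_succ_iff.1 i.2)),
      ← Fin.sum_univ_eq_sum_range (fun l => (u i).coeff l * x ^ l)]
    rfl
  have hfac : (of fun i j : Fin (s + 1) => homogeneousMoment d s a i j)
      = L * (of fun i j : Fin (s + 1) => ((d + i + j).factorial : ℝ)) * Lᵀ := by
    ext i j
    rw [of_apply, homogeneousMoment_eq_integral_eval d ha (Nat.lt_succ_iff.1 j.2)]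
    change ∫ x in Set.Ioi (0 : ℝ), x ^ d * Real.exp (-x) * ((u i).eval x * (u j).eval x) = _
    have h1 : ∀ x, x ^ d * Real.exp (-x) * ((u i).eval x * (u j).eval x)
        = ∑ l' : Fin (s + 1), ∑ l : Fin (s + 1),
          L i l * L j l' * (x ^ (d + l + l') * Real.exp (-x)) := by
      intro x
      rw [hev, hev, Finset.sum_mul_sum, Finset.sum_comm, Finset.mul_sum]
      refine Finset.sum_congr rfl fun l' _ => ?_
      rw [Finset.mul_sum]
      refine Finset.sum_congr rfl fun l _ => ?_
      ring
    simp_rw [h1]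
    rw [integral_finsetSum _ fun l' _ => integrable_finsetSum _ fun l _ =>
      (integrableOn_pow_mul_exp_neg _).integrable.const_mul _]
    rw [Matrix.mul_apply]
    refine Finset.sum_congr rfl fun l' _ => ?_
    rw [integral_finsetSum _ fun l _ => (integrableOn_pow_mul_exp_neg _).integrable.const_mul _,
      Matrix.mul_apply, Finset.sum_mul]
    refine Finset.sum_congr rfl fun l _ => ?_
    have h2 := integral_pow_mul_exp_neg_mul (d + l + l') one_pos
    simp only [one_mul, inv_one, one_pow, mul_one] at h2
    rw [integral_const_mul, h2, of_apply, transpose_apply]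
    ring
  rw [hfac, det_mul, det_mul, det_transpose, hdetL, det_factorial_add]
  ring

end hankel

/-! ### The closed form of the mean -/

section closedForm
open Polynomial

/-- Substituting `t = a x` in the integral representation of the confluent hypergeometric
function. -/
theorem vartheta_eq_pow_mul_homogeneousMoment (d s : ℕ) {a : ℝ} (ha : 0 < a) {m n : ℕ}
    (hm : m ≤ s) (hn : n ≤ s + 1) :
    vartheta (d + s + 1) (s + 1) ((d + m + n : ℕ) + 1) a
      = a ^ (d + m + n + 1) * homogeneousMoment d s a m n := by
  have hΓ : Real.Gamma (((d + m + n : ℕ) : ℝ) + 1) ≠ 0 :=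
    (Real.Gamma_pos_of_pos (by positivity)).ne'
  rw [vartheta, hyperU, mul_inv_cancel_left₀ hΓ]
  have h := integral_comp_mul_left_Ioi' (fun t : ℝ => Real.exp (-(1 / a * t)) *
    t ^ (((d + m + n : ℕ) : ℝ) + 1 - 1) *
    (1 + t) ^ ((((d + s + 1 : ℕ) : ℝ) + ((s + 1 : ℕ) : ℝ)) - (((d + m + n : ℕ) : ℝ) + 1) - 1)) 0 ha
  rw [mul_zero] at h
  rw [← h, smul_eq_mul, pow_succ, mul_comm (a ^ _) a, mul_assoc, homogeneousMoment,
    ← integral_const_mul (a ^ (d + m + n))]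
  congr 1
  refine setIntegral_congr_fun measurableSet_Ioi fun x hx => ?_
  have hx : 0 < x := hx
  have hx1 : 0 < 1 + a * x := by positivity
  have e1 : ((d + s + 1 : ℕ) : ℝ) + ((s + 1 : ℕ) : ℝ) - (((d + m + n : ℕ) : ℝ) + 1) - 1
      = ((s - m + (s + 1 - n) : ℕ) : ℝ) - 1 := by
    push_cast [Nat.cast_sub hm, Nat.cast_sub hn]; ring
  have e2 : 1 / a * (a * x) = x := by field_simp
  simp only [e1, e2, add_sub_cancel_right]
  rw [Real.rpow_natCast, Real.rpow_sub_one hx1.ne', Real.rpow_natCast, mul_pow, div_eq_mul_inv]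
  ring

/-- The two cases in the definition of the entries merge into one formula through the truncated
subtraction `n_s + j - s`. -/
theorem xiBar_apply (ns d s : ℕ) {a : ℝ} (ha : 0 < a) (ρ : ℝ) (i j : Fin (s + 1)) :
    xiBar ns (d + s + 1) (s + 1) a ρ i j = homogeneousMoment d s a i j +
      ρ * a / ns * ((ns + j - s : ℕ) : ℝ) * homogeneousMoment d s a i (j + 1) := by
  have hi := Nat.lt_succ_iff.1 i.2
  have hj := Nat.lt_succ_iff.1 j.2
  have hτ : ((d + s + 1 : ℕ) : ℝ) - ((s + 1 : ℕ) : ℝ) + ((i : ℕ) + 1 : ℕ) + ((j : ℕ) + 1 : ℕ)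
      = ((d + i + (j + 1) : ℕ) : ℝ) + 1 := by push_cast; ring
  have hτ1 : ((d + i + (j + 1) : ℕ) : ℝ) + 1 - 1 = ((d + i + j : ℕ) : ℝ) + 1 := by
    push_cast; ring
  have hpow : a ^ (1 - (((d + i + (j + 1) : ℕ) : ℝ) + 1)) = (a ^ (d + i + j + 1))⁻¹ := by
    rw [show (1 - (((d + i + (j + 1) : ℕ) : ℝ) + 1)) = -((d + i + j + 1 : ℕ) : ℝ) by
      push_cast; ring, Real.rpow_neg ha.le, Real.rpow_natCast]
  have hne : a ^ (d + i + j + 1) ≠ 0 := by positivity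
  rw [xiBar, of_apply, xiBarEntry]
  simp only [hτ, hτ1, hpow]
  rw [vartheta_eq_pow_mul_homogeneousMoment d s ha hi (by omega : (j : ℕ) ≤ s + 1),
    vartheta_eq_pow_mul_homogeneousMoment d s ha hi (by omega : (j : ℕ) + 1 ≤ s + 1)]
  split_ifs with h
  · rw [show ns + (j : ℕ) - s = 0 by omega]
    field_simp
    simp
  · rw [Nat.cast_sub (by omega)]
    rw [show d + i + (j + 1) + 1 = d + i + j + 1 + 1 by ring, pow_succ]
    push_cast
    field_simp
    ring

theorem normConst_eq (d s : ℕ) : normConst (d + s + 1) (s + 1)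
    = (∏ k ∈ Finset.range (s + 1), ((k.factorial : ℝ) * (d + k).factorial))⁻¹ := by
  rw [normConst, ← Finset.prod_range_reflect, ← Finset.Ico_add_one_right_eq_Icc,
    Finset.prod_Ico_eq_prod_range]
  congr 1
  refine Finset.prod_congr (by simp) fun k hk => ?_
  have hk : k ≤ s := by simp at hk; omega
  rw [← Real.Gamma_nat_eq_factorial, ← Real.Gamma_nat_eq_factorial,
    show s + 1 - 1 - k = s - k by omega]
  congr 2 <;> push_cast [Nat.cast_sub hk] <;> ring

/-- The mean of the rate determinant in terms of the coefficients of `wishartRatioPoly` around `a`.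
The products run over the numbers `c (n_s - i)`, written in the form in which they appear in the
columns of `Ξ̄`. -/
theorem fallingPairing_wishartRatioPoly_comp (ns r s : ℕ) (a c : ℝ) :
    fallingPairing ℝ ns ((wishartRatioPoly (r + 1) (s + 1) a).comp (C a + C c * X))
      = ∑ k ∈ Finset.range (s + 2), wishartRatioCoeff (r + 1) (s + 1) a k *
          ∏ i ∈ Finset.range k, (c * ((ns + (s - i) - s : ℕ) : ℝ)) := by
  have hcomp : (wishartRatioPoly (r + 1) (s + 1) a).comp (C a + C c * X)
      = ((wishartRatioPoly (r + 1) (s + 1) a).comp (C a + X)).comp (C c * X) := by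
    rw [comp_assoc, add_comp, C_comp, X_comp]
  have hdeg := wishartRatioPoly_comp_natDegree_le (q := s + 1) (by omega) (r + 1) a
  rw [hcomp, fallingPairing_eq_sum_range ns (s + 2)]
  · refine Finset.sum_congr rfl fun k hk => ?_
    have hk : k < s + 2 := Finset.mem_range.1 hk
    rw [comp_C_mul_X_coeff, Finset.prod_mul_distrib, Finset.prod_const, Finset.card_range,
      Nat.descFactorial_eq_prod_range, wishartRatioCoeff]
    have h1 : ∏ i ∈ Finset.range k, ((ns + (s - i) - s : ℕ) : ℝ)
        = ((∏ i ∈ Finset.range k, (ns - i) : ℕ) : ℝ) := by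
      push_cast
      refine Finset.prod_congr rfl fun i hi => ?_
      have := Finset.mem_range.1 hi
      congr 1
      omega
    rw [h1]
    ring
  · refine Nat.lt_succ_of_le (natDegree_le_iff_coeff_eq_zero.2 fun N hN => ?_)
    rw [comp_C_mul_X_coeff, coeff_eq_zero_of_natDegree_lt (by omega), zero_mul]

theorem meanRateDet_eq_capacityBoundArg {ns nr nd : ℕ} (hnr : 1 ≤ nr) (hnd : 1 ≤ nd) {α ρ : ℝ}
    (ha : 0 < relayFactor nr α ρ) : meanRateDet ns nr nd α ρ = capacityBoundArg ns nr nd α ρ := by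
  set a := relayFactor nr α ρ with hadef
  obtain ⟨s, hs⟩ : ∃ s, min nd nr = s + 1 := ⟨min nd nr - 1, by omega⟩
  obtain ⟨d, hd⟩ : ∃ d, max nd nr = d + s + 1 := ⟨max nd nr - min nd nr, by omega⟩
  rw [meanRateDet, capacityBoundArg, ← hadef, hs, hd, fallingPairing_wishartRatioPoly_comp]
  have hXi : xiBar ns (d + s + 1) (s + 1) a ρ = of fun i j : Fin (s + 1) =>
      homogeneousMoment d s a i j + (ρ * a / ns * ((ns + j - s : ℕ) : ℝ)) *
        homogeneousMoment d s a i (j + 1) := by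
    ext i j
    exact xiBar_apply ns d s ha ρ i j
  have hrel : ∀ i : Fin (s + 1), ∑ k ∈ Finset.range (s + 2),
      (-1) ^ k * wishartRatioCoeff (d + s + 1) (s + 1) a k *
        homogeneousMoment d s a i (s + 1 - k) = 0 := by
    intro i
    have := sum_wishartRatioCoeff_mul_homogeneousMoment (r := d + s) (s := s) (by omega) ha
      (Nat.lt_succ_iff.1 i.2)
    rwa [Nat.add_sub_cancel] at this
  rw [hXi, det_add_mul_succ_of_sum_eq_zero (fun n (i : Fin (s + 1)) => homogeneousMoment d s a i n)
    (wishartRatioCoeff (d + s + 1) (s + 1) a) (fun n => ρ * a / ns * ((ns + n - s : ℕ) : ℝ))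
    (wishartRatioCoeff_zero (by omega) _ ha.le) hrel, det_homogeneousMoment d s ha.le,
    normConst_eq, inv_mul_cancel_left₀]
  exact Finset.prod_ne_zero_iff.2 fun k _ => by positivity

end closedForm

theorem mainTheorem6 {Ω : Type*} [MeasurableSpace Ω] (μ : Measure Ω) [IsProbabilityMeasure μ]
    (ns nr nd : ℕ) (hns : 1 ≤ ns) (hnr : 1 ≤ nr) (hnd : 1 ≤ nd)
    (α ρ : ℝ) (hα : 0 < α) (hρ : 0 ≤ ρ)
    (H₁ : Ω → Matrix (Fin nr) (Fin ns) ℂ) (H₂ : Ω → Matrix (Fin nd) (Fin nr) ℂ)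
    (hH : IsRayleighDualHop μ H₁ H₂) :
    Integrable (fun ω => logDetRate α ρ (H₁ ω) (H₂ ω)) μ ∧
    0 < capacityBoundArg ns nr nd α ρ ∧
    ergodicCapacity μ α ρ H₁ H₂ ≤ (1 / 2) * Real.logb 2 (capacityBoundArg ns nr nd α ρ) := by
  have ha : 0 < relayFactor nr α ρ := relayFactor_pos hnr hα hρ
  rw [← meanRateDet_eq_capacityBoundArg hnr hnd ha]
  exact ergodicCapacity_le_logb_meanRateDet hnr hnd hρ ha.le hH
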